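/- Call $f:\{0,1\}^n\to\{0,1\}$ monotone if $f(x)\le f(y)$ whenever $x_i\le y_i$ for all $i$, and $\epsilon$-far from monotone if every monotone $g:\{0,1\}^n\to\{0,1\}$ differs from $f$ on at least $\epsilon 2^n$ points. A randomized algorithm with query access to $f$ is $r$-round-adaptive if it makes $r+1$ successive batches of queries (sets $Q_0,\dots,Q_r\subseteq\{0,1\}^n$), where $Q_t$ depends only on the algorithm's own randomness and on the values of $f$ on $Q_0,\dots,Q_{t-1}$, and then accepts or rejects. It is a (two-sided error) $\epsilon$-tester for monotonicity if it accepts every monotone $f$ with probability at least $2/3$ and rejects every $f$ that is $\epsilon$-far from monotone with probability at least $2/3$. Theorem. For every constant $r\in\mathbb N=\{0,1,2,\dots\}$ there is a constant $\epsilon_r>0$ such that any two-sided error, $r$-round-adaptive algorithm for testing whether an unknown Boolean function $f:\{0,1\}^n\to\{0,1\}$ is monotone or $\epsilon_r$-far from monotone must make $\tilde\Omega(\sqrt n)$ queries. That is, there are constants $c>0$ and $k, n_0\in\mathbb N$, depending only on $r$, such that for every $n\ge n_0$ every $r$-round-adaptive $\epsilon_r$-tester for monotonicity of functions on $\{0,1\}^n$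 makes, in the worst case over $f$ and over its own randomness, a total of at least $c\sqrt n/(\log n)^k$ queries. -/

import Mathlib

namespace MonotonicityTesting

/-- The Boolean cube `{0,1}^n`, with the coordinatewise order (`false < true`). -/
abbrev Cube (n : ℕ) : Type := Fin n → Bool

/-- `f` is `ε`-far from monotone: every monotone `g` disagrees with `f` on at least `ε 2^n`
points (`hammingDist f g` is the number of `x` with `f x ≠ g x`). -/
def IsFarFromMonotone {n : ℕ} (ε : ℝ) (f : Cube n → Bool) : Prop :=
  ∀ g : Cube n → Bool, Monotone g → ε * 2 ^ n ≤ (hammingDist f g : ℝ)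

/-- Deterministic query algorithms for functions `f : {0,1}^n → {0,1}` that make `k` successive
batches of queries. Either no batch is left and the algorithm outputs a verdict (`true` means
accept), or it submits a finite set `Q` of points, receives all the values of `f` on `Q`, and
continues, depending on these answers, with an algorithm that makes the remaining batches.
A batch may be empty. -/
inductive BatchAlgorithm (n : ℕ) : ℕ → Type
  | verdict (b : Bool) : BatchAlgorithm n 0
  | batch {k : ℕ} (Q : Finset (Cube n)) (next : (Q → Bool) → BatchAlgorithm n k) :
      BatchAlgorithm n (k + 1)

namespace BatchAlgorithm

/-- The verdict of the algorithm on the function `f`. -/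
def run {n : ℕ} (f : Cube n → Bool) : {k : ℕ} → BatchAlgorithm n k → Bool
  | _, verdict b => b
  | _, batch _ next => (next fun x => f x).run f

/-- The total number of queries, over all batches, that the algorithm makes on `f`. -/
def queries {n : ℕ} (f : Cube n → Bool) : {k : ℕ} → BatchAlgorithm n k → ℕ
  | _, verdict _ => 0
  | _, batch Q next => Q.card + (next fun x => f x).queries f

end BatchAlgorithm

/-- A randomized `r`-round-adaptive algorithm: a probability distribution over deterministic
algorithms that make `r + 1` batches of queries. -/
abbrev RoundAdaptiveAlgorithm (n r : ℕ) : Type := PMF (BatchAlgorithm n (r + 1))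

/-- The probability that the algorithm gives the verdict `b` on the function `f`. -/
noncomputable def RoundAdaptiveAlgorithm.prob {n r : ℕ} (A : RoundAdaptiveAlgorithm n r)
    (f : Cube n → Bool) (b : Bool) : ENNReal :=
  (PMF.map (fun T => T.run f) A) b

/-- `A` is a two-sided error `ε`-tester for monotonicity. -/
def IsMonotonicityTester {n r : ℕ} (ε : ℝ) (A : RoundAdaptiveAlgorithm n r) : Prop :=
  (∀ f : Cube n → Bool, Monotone f → 2 / 3 ≤ A.prob f true) ∧
    ∀ f : Cube n → Bool, IsFarFromMonotone ε f → 2 / 3 ≤ A.prob f false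

end MonotonicityTesting

/-! By averaging over the algorithm's randomness, it suffices to find two random families of
functions, one monotone and one far from monotone, that no deterministic algorithm with `L = r + 1`
batches and few queries tells apart.

Both come from a multilevel Talagrand function: a tree with `L` levels that alternate between terms
and clauses. Each coordinate enters the constraint of each node independently with probability `1 /
M`, where `M` is about `√n`, and the number `N` of children is such that a point in the middle
layers satisfies about one child of a node on average. A point with exactly one satisfied child at
every level reaches a leaf; elsewhere the value is forced in a way that keeps the function monotone
for constant leaves. The monotone family puts a random bit on each leaf. The other family adds to it
the parity of two random coordinates `a` and `b`.

The second family is often far from monotone: a middle square in the directions `a` and `b` lies in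
one leaf with constant probability (`le_card_squareInLeaf`), and there the parity violates
monotonicity whatever the bit (`card_squareInLeaf_le`). Only outcomes with many such squares are
kept (`goodOutcomes`).

The families look alike as long as queries in a common leaf agree at `a` and at `b`: the parity seen
in a leaf is then a constant, which the random bit absorbs (`card_run_constFun_le`). So the
algorithm must explore `a` or `b`, that is, vary it inside a leaf. A query that changes more than
about `√n log n` coordinates to values that the still unknown constraint of a node forbids is
unlikely to satisfy this node (`card_not_gapsAtMost_le`). Since polarities alternate, a node and its
parent together control both directions of change. One batch can exploit what it learns only one
level deeper, so after `L` batches each query accounts for about `√n log n` explored coordinates at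
leaf level (`card_explored_le`). Hence `q` queries explore about `q √n log n` of the `n`
coordinates, and `q` must be at least of order `√n / log n`. -/

namespace MonotonicityTesting

/-! ### Transcripts of batch algorithms -/

namespace BatchAlgorithm

variable {n : ℕ}

/-- The set of points that the algorithm queries on `f` in its batch number `t`. -/
def batchAt (f : Cube n → Bool) : {k : ℕ} → BatchAlgorithm n k → ℕ → Finset (Cube n)
  | _, verdict _, _ => ∅
  | _, batch Q _, 0 => Q
  | _, batch _ next, t + 1 => (next fun x => f x).batchAt f t

/-- The set of points that the algorithm queries on `f` in its first `t` batches. -/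
def asked (f : Cube n → Bool) {k : ℕ} (T : BatchAlgorithm n k) (t : ℕ) : Finset (Cube n) :=
  (Finset.range t).biUnion (T.batchAt f)

theorem mem_asked {f : Cube n → Bool} {k : ℕ} {T : BatchAlgorithm n k} {t : ℕ} {x : Cube n} :
    x ∈ T.asked f t ↔ ∃ i < t, x ∈ T.batchAt f i := by
  simp [asked]

theorem mem_asked_succ {f : Cube n → Bool} {k : ℕ} {T : BatchAlgorithm n k} {t : ℕ} {x : Cube n} :
    x ∈ T.asked f (t + 1) ↔ x ∈ T.asked f t ∨ x ∈ T.batchAt f t := by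
  simp only [mem_asked]
  constructor
  · rintro ⟨i, hi, hx⟩
    rcases Nat.lt_succ_iff_lt_or_eq.1 hi with h | rfl
    · exact Or.inl ⟨i, h, hx⟩
    · exact Or.inr hx
  · rintro (⟨i, hi, hx⟩ | hx)
    · exact ⟨i, by omega, hx⟩
    · exact ⟨t, by omega, hx⟩

/-- Batch `t` is fixed before its own answers arrive, so agreement on the first `t` batches is
enough. The resetting argument for gaps uses exactly this. -/
theorem batchAt_congr {f g : Cube n → Bool} {k : ℕ} (T : BatchAlgorithm n k) (t : ℕ)
    (h : ∀ x ∈ T.asked f t, f x = g x) : T.batchAt f t = T.batchAt g t := by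
  induction T generalizing t with
  | verdict b => simp [batchAt]
  | batch Q next ih =>
    cases t with
    | zero => simp [batchAt]
    | succ t =>
      have h0 : (fun x : Q => f x) = fun x : Q => g x := by
        funext x
        exact h x (mem_asked.2 ⟨0, by omega, by simp [batchAt]⟩)
      simp only [batchAt]
      rw [← h0]
      refine ih _ t fun x hx => ?_
      obtain ⟨i, hi, hx⟩ := mem_asked.1 hx
      exact h x (mem_asked.2 ⟨i + 1, by omega, by simpa [batchAt] using hx⟩)

theorem asked_congr {f g : Cube n → Bool} {k : ℕ} (T : BatchAlgorithm n k) (t : ℕ)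
    (h : ∀ x ∈ T.asked f t, f x = g x) : T.asked f t = T.asked g t := by
  unfold asked
  refine Finset.biUnion_congr rfl fun i hi => T.batchAt_congr i fun x hx => h x ?_
  obtain ⟨j, hj, hx⟩ := mem_asked.1 hx
  exact mem_asked.2 ⟨j, hj.trans (Finset.mem_range.1 hi), hx⟩

theorem run_congr {f g : Cube n → Bool} {k : ℕ} (T : BatchAlgorithm n k)
    (h : ∀ x ∈ T.asked f k, f x = g x) : T.run f = T.run g := by
  induction T with
  | verdict b => simp [run]
  | batch Q next ih =>
    have h0 : (fun x : Q => f x) = fun x : Q => g x := by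
      funext x
      exact h x (mem_asked.2 ⟨0, by omega, by simp [batchAt]⟩)
    simp only [run]
    rw [← h0]
    refine ih _ fun x hx => ?_
    obtain ⟨i, hi, hx⟩ := mem_asked.1 hx
    exact h x (mem_asked.2 ⟨i + 1, by omega, by simpa [batchAt] using hx⟩)

theorem sum_card_batchAt (f : Cube n → Bool) {k : ℕ} (T : BatchAlgorithm n k) :
    ∑ t ∈ Finset.range k, (T.batchAt f t).card = T.queries f := by
  induction T with
  | verdict b => simp [queries]
  | batch Q next ih =>
    rw [Finset.sum_range_succ']
    simp only [batchAt, queries]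
    rw [ih, add_comm]

theorem card_asked_le (f : Cube n → Bool) {k : ℕ} (T : BatchAlgorithm n k) {t : ℕ} (ht : t ≤ k) :
    (T.asked f t).card ≤ T.queries f := by
  rw [← T.sum_card_batchAt f]
  refine Finset.card_biUnion_le.trans ?_
  exact Finset.sum_le_sum_of_subset (Finset.range_subset_range.2 ht)

theorem card_batchAt_le (f : Cube n → Bool) {k : ℕ} (T : BatchAlgorithm n k) {t : ℕ} (ht : t < k) :
    (T.batchAt f t).card ≤ T.queries f := by
  rw [← T.sum_card_batchAt f]
  exact Finset.single_le_sum (f := fun t => (T.batchAt f t).card) (fun _ _ => Nat.zero_le _)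
    (Finset.mem_range.2 ht)

end BatchAlgorithm

end MonotonicityTesting

/-! ### Multilevel Talagrand functions -/

namespace MonotonicityTesting

variable {n N : ℕ}

/-- The number of ones of a point. -/
def weight (x : Cube n) : ℕ := (Finset.univ.filter fun c => x c = true).card

/-- The points whose weight differs from `n / 2` by at most `w`. -/
def IsMiddle (w : ℕ) (x : Cube n) : Prop := n ≤ 2 * weight x + 2 * w ∧ 2 * weight x ≤ n + 2 * w

/-- The value that the constraints of the children of the node `l` ask for: the levels of the tree
alternate between terms (`true`) and clauses (`false`). -/
def polarity (l : List (Fin N)) : Bool := decide (Even l.length)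

theorem polarity_cons (j : Fin N) (l : List (Fin N)) : polarity (j :: l) = !polarity l := by
  simp [polarity, Nat.even_add_one, -Nat.not_even_iff_odd]

/-- The children of the node `l` whose constraint `x` satisfies. -/
def sats (D : List (Fin N) → Finset (Fin n)) (l : List (Fin N)) (x : Cube n) : Finset (Fin N) :=
  Finset.univ.filter fun j => ∀ c ∈ D (j :: l), x c = polarity l

theorem mem_sats {D : List (Fin N) → Finset (Fin n)} {l : List (Fin N)} {x : Cube n} {j : Fin N} :
    j ∈ sats D l x ↔ ∀ c ∈ D (j :: l), x c = polarity l := by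
  simp [sats]

/-- The middle point `x` satisfies exactly one child of each node on the way to the given one. -/
def Reach (w : ℕ) (D : List (Fin N) → Finset (Fin n)) : List (Fin N) → Cube n → Prop
  | [], x => IsMiddle w x
  | j :: l, x => Reach w D l x ∧ sats D l x = {j}

/-- The point `x` reaches the parent of the given node and satisfies the node and at most one of its
siblings. -/
def Touch (w : ℕ) (D : List (Fin N) → Finset (Fin n)) : List (Fin N) → Cube n → Prop
  | [], x => IsMiddle w x
  | j :: l, x => Reach w D l x ∧ j ∈ sats D l x ∧ (sats D l x).card ≤ 2

/-- The value at `x` of the tree with `k` levels below the node `l` and leaf values `g`. -/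
def treeEval (D : List (Fin N) → Finset (Fin n)) (g : List (Fin N) → Bool) (x : Cube n) :
    ℕ → List (Fin N) → Bool
  | 0, l => g l
  | k + 1, l =>
    if (sats D l x).card = 0 then !polarity l
    else if (sats D l x).card = 1 then
      decide (∃ j ∈ sats D l x, treeEval D g x k (j :: l) = true)
    else polarity l

/-- The multilevel Talagrand function with `L` levels of constraints `D` and leaf values `g`. -/
def treeFun (w L : ℕ) (D : List (Fin N) → Finset (Fin n)) (g : List (Fin N) → Bool)
    (x : Cube n) : Bool :=
  if n + 2 * w < 2 * weight x then true
  else if 2 * weight x + 2 * w < n then false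
  else treeEval D g x L []

theorem Reach.touch {w : ℕ} {D : List (Fin N) → Finset (Fin n)} {v : List (Fin N)} {x : Cube n}
    (h : Reach w D v x) : Touch w D v x := by
  cases v with
  | nil => exact h
  | cons j l => exact ⟨h.1, by simp [h.2], by simp [h.2]⟩

theorem Reach.isMiddle {w : ℕ} {D : List (Fin N) → Finset (Fin n)} {v : List (Fin N)} {x : Cube n}
    (h : Reach w D v x) : IsMiddle w x := by
  induction v with
  | nil => exact h
  | cons j l ih => exact ih h.1

theorem Touch.isMiddle {w : ℕ} {D : List (Fin N) → Finset (Fin n)} {v : List (Fin N)} {x : Cube n}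
    (h : Touch w D v x) : IsMiddle w x := by
  cases v with
  | nil => exact h
  | cons j l => exact h.1.isMiddle

theorem Reach.unique {w : ℕ} {D : List (Fin N) → Finset (Fin n)} {u v : List (Fin N)} {x : Cube n}
    (hu : Reach w D u x) (hv : Reach w D v x) (h : u.length = v.length) : u = v := by
  induction u generalizing v with
  | nil => exact (List.length_eq_zero_iff.1 (by simpa using h.symm)).symm
  | cons j l ih =>
    cases v with
    | nil => simp at h
    | cons i m =>
      obtain rfl := ih hu.1 hv.1 (by simpa using h)
      rw [Finset.singleton_injective (hu.2.symm.trans hv.2)]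

theorem treeEval_of_sats_eq {D : List (Fin N) → Finset (Fin n)} {g : List (Fin N) → Bool}
    {x : Cube n} {l : List (Fin N)} {j : Fin N} (h : sats D l x = {j}) (k : ℕ) :
    treeEval D g x (k + 1) l = treeEval D g x k (j :: l) := by
  simp [treeEval, h]

theorem treeFun_of_isMiddle {w L : ℕ} {D : List (Fin N) → Finset (Fin n)}
    {g : List (Fin N) → Bool} {x : Cube n} (h : IsMiddle w x) :
    treeFun w L D g x = treeEval D g x L [] := by
  have h1 : ¬ n + 2 * w < 2 * weight x := not_lt.2 h.2
  have h2 : ¬ 2 * weight x + 2 * w < n := not_lt.2 h.1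
  simp [treeFun, h1, h2]

theorem treeEval_of_reach {w : ℕ} {D : List (Fin N) → Finset (Fin n)} {g : List (Fin N) → Bool}
    {x : Cube n} {u : List (Fin N)} (h : Reach w D u x) (k : ℕ) :
    treeEval D g x (k + u.length) [] = treeEval D g x k u := by
  induction u generalizing k with
  | nil => simp
  | cons j l ih =>
    rw [← treeEval_of_sats_eq h.2, ← ih h.1, List.length_cons]
    congr 1
    omega

theorem treeFun_of_reach {w L : ℕ} {D : List (Fin N) → Finset (Fin n)} {g : List (Fin N) → Bool}
    {x : Cube n} {u : List (Fin N)} (h : Reach w D u x) (hL : u.length = L) :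
    treeFun w L D g x = g u := by
  rw [treeFun_of_isMiddle h.isMiddle, ← hL, ← zero_add u.length, treeEval_of_reach h]
  rfl

/-- The evaluation descends only through nodes with a single satisfied child, so a leaf value enters
only at points that reach the leaf. -/
theorem treeFun_congr_leaf {w L : ℕ} {D : List (Fin N) → Finset (Fin n)}
    {g g' : List (Fin N) → Bool} {x : Cube n}
    (h : ∀ u : List (Fin N), u.length = L → Reach w D u x → g u = g' u) :
    treeFun w L D g x = treeFun w L D g' x := by
  have key : ∀ k l, l.length + k = L → Reach w D l x →
      treeEval D g x k l = treeEval D g' x k l := by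
    intro k
    induction k with
    | zero => exact fun l hl hr => h l (by simpa using hl) hr
    | succ k ih =>
      intro l hl hr
      by_cases h1 : (sats D l x).card = 1
      · obtain ⟨j, hj⟩ := Finset.card_eq_one.1 h1
        rw [treeEval_of_sats_eq hj, treeEval_of_sats_eq hj]
        exact ih _ (by simp; omega) ⟨hr, hj⟩
      · simp [treeEval, h1]
  by_cases hm : IsMiddle w x
  · rw [treeFun_of_isMiddle hm, treeFun_of_isMiddle hm]
    exact key L [] (by simp) hm
  · simp only [IsMiddle, not_and_or, not_le] at hm
    simp only [treeFun]
    split_ifs <;> first | rfl | omega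

theorem reach_congr {w : ℕ} {D D' : List (Fin N) → Finset (Fin n)} {l : List (Fin N)} {x : Cube n}
    (h : ∀ v : List (Fin N), v.length ≤ l.length → D v = D' v) :
    Reach w D l x ↔ Reach w D' l x := by
  induction l with
  | nil => exact Iff.rfl
  | cons j l ih =>
    have hs : sats D l x = sats D' l x := by
      ext i
      rw [mem_sats, mem_sats, h (i :: l) (by simp)]
    rw [Reach, Reach, ih fun v hv => h v (by simp; omega), hs]

/-- The constraint of a node matters only at points that touch the node. This is why `Touch` admits
a second satisfied child: dropping one of two changes the case of the evaluation, while dropping one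
of three or more does not. -/
theorem treeFun_congr_tree {w L : ℕ} {D D' : List (Fin N) → Finset (Fin n)}
    {g : List (Fin N) → Bool} {x : Cube n} {j : Fin N} {l : List (Fin N)}
    (hD : ∀ v, v ≠ j :: l → D v = D' v)
    (ht : Touch w D (j :: l) x ↔ Touch w D' (j :: l) x) :
    treeFun w L D g x = treeFun w L D' g x := by
  have hother : ∀ l' i, (i :: l' : List (Fin N)) ≠ j :: l → (i ∈ sats D l' x ↔ i ∈ sats D' l' x) := by
    intro l' i hi
    rw [mem_sats, mem_sats, hD _ hi]
  have hreach : Reach w D l x ↔ Reach w D' l x := reach_congr fun v hv => hD v fun h => by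
    simp [h] at hv
  have key : ∀ k l', Reach w D l' x → treeEval D g x k l' = treeEval D' g x k l' := by
    intro k
    induction k with
    | zero => exact fun l _ => rfl
    | succ k ih =>
      intro l' hr
      by_cases hs : sats D l' x = sats D' l' x
      · by_cases h1 : (sats D l' x).card = 1
        · obtain ⟨i, hi⟩ := Finset.card_eq_one.1 h1
          rw [treeEval_of_sats_eq hi, treeEval_of_sats_eq (hs ▸ hi)]
          exact ih _ ⟨hr, hi⟩
        · simp [treeEval, ← hs, h1]
      · obtain rfl : l' = l := by
          by_contra hl
          exact hs (Finset.ext fun i => hother l' i (by simp [hl]))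
        have hj : ¬ (j ∈ sats D l' x ↔ j ∈ sats D' l' x) := by
          intro hj
          refine hs (Finset.ext fun i => ?_)
          by_cases hi : i = j
          · rw [hi, hj]
          · exact hother l' i (by simp [hi])
        have herase : (sats D l' x).erase j = (sats D' l' x).erase j := by
          ext i
          by_cases hi : i = j
          · simp [hi]
          · simp [hi, hother l' i (by simp [hi])]
        have hcard := congrArg Finset.card herase
        simp only [Touch, ← hreach, hr, true_and] at ht
        rw [Finset.card_erase_eq_ite, Finset.card_erase_eq_ite] at hcard
        -- The point satisfies `j` under just one of the two constraints, and touches the node under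
        -- neither. So there are at least three satisfied children on one side and one fewer on the
        -- other.
        have hlarge : 2 ≤ (sats D l' x).card ∧ 2 ≤ (sats D' l' x).card := by
          by_cases h1 : j ∈ sats D l' x <;> by_cases h2 : j ∈ sats D' l' x <;>
            simp only [h1, h2, true_and, false_and, if_true, if_false, iff_true, iff_false,
              false_iff, not_true, not_false_iff] at ht hj hcard <;> omega
        have e1 : ¬ (sats D l' x).card = 0 := by omega
        have e2 : ¬ (sats D l' x).card = 1 := by omega
        have e3 : ¬ (sats D' l' x).card = 0 := by omega
        have e4 : ¬ (sats D' l' x).card = 1 := by omega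
        rw [treeEval, treeEval, if_neg e1, if_neg e2, if_neg e3, if_neg e4]
  by_cases hm : IsMiddle w x
  · rw [treeFun_of_isMiddle hm, treeFun_of_isMiddle hm]
    exact key L [] hm
  · simp only [IsMiddle, not_and_or, not_le] at hm
    simp only [treeFun]
    split_ifs <;> first | rfl | omega

theorem weight_mono {x y : Cube n} (h : x ≤ y) : weight x ≤ weight y := by
  refine Finset.card_le_card fun c hc => ?_
  simp only [Finset.mem_filter, Finset.mem_univ, true_and] at hc ⊢
  exact Bool.le_iff_imp.1 (h c) hc

/-- Raising a point adds satisfied children at the levels of terms and removes them at the levels of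
clauses. The default values for no child and for several children are ordered accordingly, so only
the case of one child before and after remains, and then the child is the same. -/
theorem treeFun_monotone (w L : ℕ) (D : List (Fin N) → Finset (Fin n)) (g : List (Fin N) → Bool) :
    Monotone (treeFun w L D g) := by
  have key : ∀ k l, ∀ x y : Cube n, x ≤ y → treeEval D g x k l ≤ treeEval D g y k l := by
    intro k
    induction k with
    | zero => exact fun l x y _ => le_rfl
    | succ k ih =>
      intro l x y hxy
      have hone : ∀ i, sats D l x = {i} → sats D l y = {i} →
          treeEval D g x (k + 1) l ≤ treeEval D g y (k + 1) l := by
        intro i hx hy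
        rw [treeEval_of_sats_eq hx, treeEval_of_sats_eq hy]
        exact ih _ x y hxy
      cases hp : polarity l with
      | true =>
        have hsub : sats D l x ⊆ sats D l y := by
          intro j hj
          rw [mem_sats, hp] at hj ⊢
          intro c hc
          exact Bool.le_iff_imp.1 (hxy c) (hj c hc)
        by_cases hx0 : (sats D l x).card = 0
        · rw [treeEval, if_pos hx0, hp]
          simp
        by_cases hy1 : (sats D l y).card = 1
        · obtain ⟨i, hi⟩ := Finset.card_eq_one.1 hy1
          refine hone i ?_ hi
          rw [hi] at hsub
          rcases Finset.subset_singleton_iff.1 hsub with h | h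
          · simp [h] at hx0
          · exact h
        · have := Finset.card_le_card hsub
          rw [treeEval.eq_2 D g y, if_neg (by omega), if_neg hy1, hp]
          exact Bool.le_true _
      | false =>
        have hsub : sats D l y ⊆ sats D l x := by
          intro j hj
          rw [mem_sats, hp] at hj ⊢
          intro c hc
          have := Bool.le_iff_imp.1 (hxy c)
          rw [hj c hc] at this
          simpa using this
        by_cases hy0 : (sats D l y).card = 0
        · rw [treeEval.eq_2 D g y, if_pos hy0, hp]
          exact Bool.le_true _
        by_cases hx1 : (sats D l x).card = 1
        · obtain ⟨i, hi⟩ := Finset.card_eq_one.1 hx1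
          refine hone i hi ?_
          rw [hi] at hsub
          rcases Finset.subset_singleton_iff.1 hsub with h | h
          · simp [h] at hy0
          · exact h
        · have := Finset.card_le_card hsub
          rw [treeEval, if_neg (by omega), if_neg hx1, hp]
          exact Bool.false_le _
  intro x y hxy
  have := weight_mono hxy
  unfold treeFun
  split_ifs <;> first
    | omega
    | exact le_rfl
    | exact Bool.false_le _
    | exact Bool.le_true _
    | exact key _ _ _ _ hxy

end MonotonicityTesting

/-! ### Growth of the set of explored coordinates -/

namespace MonotonicityTesting

variable {n N : ℕ}

open Classical in
/-- The coordinates on which all points of `A` that touch the node `j :: l` and also `x` have the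
value that the constraint of this node asks for, but `y` has not. -/
noncomputable def gap (w : ℕ) (D : List (Fin N) → Finset (Fin n)) (A : Finset (Cube n)) (j : Fin N)
    (l : List (Fin N)) (x y : Cube n) : Finset (Fin n) :=
  Finset.univ.filter fun c => (∀ z ∈ A, Touch w D (j :: l) z → z c = polarity l) ∧
    x c = polarity l ∧ y c ≠ polarity l

open Classical in
/-- The coordinates on which two points of `A` that touch a common node of level `t` differ. -/
noncomputable def explored (w : ℕ) (D : List (Fin N) → Finset (Fin n)) (A : Finset (Cube n))
    (t : ℕ) : Finset (Fin n) :=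
  Finset.univ.filter fun c => ∃ v : List (Fin N), v.length = t ∧
    ∃ x ∈ A, ∃ y ∈ A, Touch w D v x ∧ Touch w D v y ∧ x c ≠ y c

/-- No query of batch `t < L` leaves a large gap at a node of level at most `t + 1` that it
touches. -/
def GapsAtMost (w d L : ℕ) (D : List (Fin N) → Finset (Fin n)) (Q : ℕ → Finset (Cube n)) : Prop :=
  ∀ t < L, ∀ j l, l.length ≤ t → ∀ x ∈ (Finset.range (t + 1)).biUnion Q, ∀ y ∈ Q t,
    Touch w D (j :: l) x → Touch w D (j :: l) y →
      (gap w D ((Finset.range t).biUnion Q) j l x y).card ≤ d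

theorem weight_add_card (x y : Cube n) :
    weight x + (Finset.univ.filter fun c => x c = false ∧ y c = true).card =
      weight y + (Finset.univ.filter fun c => x c = true ∧ y c = false).card := by
  unfold weight
  rw [← Finset.card_union_of_disjoint, ← Finset.card_union_of_disjoint]
  · congr 1
    ext c
    cases hx : x c <;> cases hy : y c <;> simp [hx, hy]
  all_goals
    rw [Finset.disjoint_filter]
    intro c _ h
    simp [h]

/-- The weights differ by at most `2 * w`, hence so do the numbers of changes in the two directions;
a bound for one direction bounds the other. -/
theorem card_ne_le_of_isMiddle {w d : ℕ} {x y : Cube n} (hx : IsMiddle w x) (hy : IsMiddle w y)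
    {b : Bool} (h : (Finset.univ.filter fun c => x c = b ∧ y c ≠ b).card ≤ d) :
    (Finset.univ.filter fun c => x c ≠ y c).card ≤ 2 * (d + w) := by
  have h1 : (Finset.univ.filter fun c => x c ≠ y c) =
      (Finset.univ.filter fun c => x c = false ∧ y c = true) ∪
        (Finset.univ.filter fun c => x c = true ∧ y c = false) := by
    ext c
    cases hx : x c <;> cases hy : y c <;> simp [hx, hy]
  have h2 := Finset.card_union_le (Finset.univ.filter fun c => x c = false ∧ y c = true)
    (Finset.univ.filter fun c => x c = true ∧ y c = false)
  rw [← h1] at h2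
  have h3 := weight_add_card x y
  have := hx.1
  have := hx.2
  have := hy.1
  have := hy.2
  cases b <;> simp only [ne_eq, Bool.not_eq_false, Bool.not_eq_true] at h <;> omega

/-- If an earlier query touched `v`, then earlier queries that touched `v` or its parent agree
outside the coordinates explored one level above, and a new query can leave their common value only
in a gap at `v` or at the parent. If `v` is touched for the first time, the gap condition bounds one
direction of change and the middle weights bound the other. -/
theorem exists_explored_increment {w d L : ℕ} {D : List (Fin N) → Finset (Fin n)}
    {Q : ℕ → Finset (Cube n)} (hQ : GapsAtMost w d L D Q) {t : ℕ} (ht : t < L)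
    (v : List (Fin N)) (hv : v.length = t + 1) :
    ∃ F : Cube n → Finset (Fin n), (∀ y ∈ Q t, Touch w D v y → (F y).card ≤ 2 * (d + w)) ∧
      ∀ c, (∃ x ∈ (Finset.range (t + 1)).biUnion Q, ∃ y ∈ (Finset.range (t + 1)).biUnion Q,
        Touch w D v x ∧ Touch w D v y ∧ x c ≠ y c) →
          c ∈ explored w D ((Finset.range t).biUnion Q) t ∨ ∃ y ∈ Q t, Touch w D v y ∧ c ∈ F y := by
  classical
  obtain ⟨j, l, rfl⟩ := List.exists_cons_of_length_eq_add_one hv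
  have hl : l.length = t := by simpa using hv
  have hsucc : ∀ x, x ∈ (Finset.range (t + 1)).biUnion Q ↔
      x ∈ Q t ∨ x ∈ (Finset.range t).biUnion Q := by
    intro x
    rw [Finset.range_add_one, Finset.biUnion_insert, Finset.mem_union]
  set A := (Finset.range t).biUnion Q with hA
  by_cases hold : ∃ x ∈ A, Touch w D (j :: l) x
  · obtain ⟨x₀, hx₀, hxt₀⟩ := hold
    obtain ⟨i, l', rfl⟩ : ∃ i l', l = i :: l' := by
      cases l with
      | nil =>
        obtain rfl : 0 = t := by simpa using hl
        simp [hA] at hx₀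
      | cons i l' => exact ⟨i, l', rfl⟩
    -- The polarities at `v` and at its parent are opposite, so the common value at any coordinate
    -- is the one asked for by exactly one of the two nodes.
    refine ⟨fun y => gap w D A j (i :: l') x₀ y ∪ gap w D A i l' x₀ y, ?_, ?_⟩
    · intro y hy hyt
      have h1 := hQ t ht j (i :: l') hl.le x₀ ((hsucc _).2 (Or.inr hx₀)) y hy hxt₀ hyt
      have h2 := hQ t ht i l' (by simp at hl; omega) x₀ ((hsucc _).2 (Or.inr hx₀)) y hy hxt₀.1.touch hyt.1.touch
      have h3 := Finset.card_union_le (gap w D A j (i :: l') x₀ y) (gap w D A i l' x₀ y)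
      rw [← hA] at h1 h2
      change (gap w D A j (i :: l') x₀ y ∪ gap w D A i l' x₀ y).card ≤ _
      omega
    · rintro c ⟨x, hx, y, hy, hxt, hyt, hne⟩
      by_contra hcon
      rw [not_or, not_exists] at hcon
      obtain ⟨hc1, hc2⟩ := hcon
      have hold : ∀ z ∈ A, Touch w D (j :: i :: l') z → z c = x₀ c := by
        intro z hz hzt
        by_contra hzc
        refine hc1 ?_
        simp only [explored, Finset.mem_filter, Finset.mem_univ, true_and]
        exact ⟨i :: l', hl, z, hz, x₀, hx₀, hzt.1.touch, hxt₀.1.touch, hzc⟩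
      have hold' : ∀ z ∈ A, Touch w D (i :: l') z → z c = x₀ c := by
        intro z hz hzt
        by_contra hzc
        refine hc1 ?_
        simp only [explored, Finset.mem_filter, Finset.mem_univ, true_and]
        exact ⟨i :: l', hl, z, hz, x₀, hx₀, hzt, hxt₀.1.touch, hzc⟩
      have hnew : ∀ z ∈ Q t, Touch w D (j :: i :: l') z → z c = x₀ c := by
        intro z hz hzt
        by_contra hzc
        refine hc2 z ⟨hz, hzt, ?_⟩
        rw [Finset.mem_union]
        by_cases hp : x₀ c = polarity (i :: l')
        · left
          simp only [gap, Finset.mem_filter, Finset.mem_univ, true_and]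
          exact ⟨fun z' hz' hzt' => (hold z' hz' hzt').trans hp, hp, hp ▸ hzc⟩
        · right
          have hp' : x₀ c = polarity l' := by
            rw [polarity_cons] at hp
            simpa using hp
          simp only [gap, Finset.mem_filter, Finset.mem_univ, true_and]
          exact ⟨fun z' hz' hzt' => (hold' z' hz' hzt').trans hp', hp', hp' ▸ hzc⟩
      have hall : ∀ z ∈ (Finset.range (t + 1)).biUnion Q, Touch w D (j :: i :: l') z →
          z c = x₀ c := fun z hz => ((hsucc z).1 hz).elim (hnew z) (hold z)
      exact hne ((hall x hx hxt).trans (hall y hy hyt).symm)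
  · push Not at hold
    have hmem : ∀ x, x ∈ (Finset.range (t + 1)).biUnion Q → Touch w D (j :: l) x → x ∈ Q t :=
      fun x hx hxt => ((hsucc x).1 hx).elim id fun h => absurd hxt (hold x h)
    by_cases hnew : ∃ x ∈ Q t, Touch w D (j :: l) x
    · obtain ⟨x₀, hx₀, hxt₀⟩ := hnew
      -- No earlier query touches the node, so the condition on earlier queries in `gap` is vacuous.
      refine ⟨fun y => Finset.univ.filter fun c => x₀ c ≠ y c, ?_, ?_⟩
      · intro y hy hyt
        refine card_ne_le_of_isMiddle hxt₀.isMiddle hyt.isMiddle (b := polarity l)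
          (le_trans (Finset.card_le_card ?_)
            (hQ t ht j l hl.le x₀ ((hsucc _).2 (Or.inl hx₀)) y hy hxt₀ hyt))
        intro c hc
        simp only [gap, Finset.mem_filter, Finset.mem_univ, true_and] at hc ⊢
        exact ⟨fun z hz hzt => absurd hzt (hold z hz), hc⟩
      · rintro c ⟨x, hx, y, hy, hxt, hyt, hne⟩
        right
        by_cases hxc : x₀ c = x c
        · exact ⟨y, hmem y hy hyt, hyt, by simpa [hxc] using hne⟩
        · exact ⟨x, hmem x hx hxt, hxt, by simpa using hxc⟩
    · push Not at hnew
      refine ⟨fun _ => ∅, fun y hy hyt => absurd hyt (hnew y hy), ?_⟩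
      rintro c ⟨x, hx, y, hy, hxt, hyt, hne⟩
      exact absurd hxt (hnew x (hmem x hx hxt))

theorem card_explored_succ_le {w d L : ℕ} {D : List (Fin N) → Finset (Fin n)}
    {Q : ℕ → Finset (Cube n)} (hQ : GapsAtMost w d L D Q) {t : ℕ} (ht : t < L) :
    (explored w D ((Finset.range (t + 1)).biUnion Q) (t + 1)).card ≤
      (explored w D ((Finset.range t).biUnion Q) t).card + 4 * (d + w) * (Q t).card := by
  classical
  choose! F hF1 hF2 using exists_explored_increment hQ ht
  let G : Cube n → Finset (Fin n) := fun y => Finset.univ.filter fun c =>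
    ∃ v : List (Fin N), v.length = t + 1 ∧ Touch w D v y ∧ c ∈ F v y
  -- All nodes that `y` touches on one level are children of the same reached parent, and there are
  -- at most two of them.
  have hG : ∀ y ∈ Q t, (G y).card ≤ 4 * (d + w) := by
    intro y hy
    by_cases h : ∃ v : List (Fin N), v.length = t + 1 ∧ Touch w D v y
    · obtain ⟨v, hv, hvt⟩ := h
      obtain ⟨j, l, rfl⟩ := List.exists_cons_of_length_eq_add_one hv
      have hsub : G y ⊆ (sats D l y).biUnion fun i => F (i :: l) y := by
        intro c hc
        simp only [G, Finset.mem_filter, Finset.mem_univ, true_and] at hc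
        obtain ⟨u, hu, hut, hc⟩ := hc
        obtain ⟨i, m, rfl⟩ := List.exists_cons_of_length_eq_add_one hu
        obtain rfl : m = l := hut.1.unique hvt.1 (by
          simp only [List.length_cons] at hu hv
          omega)
        exact Finset.mem_biUnion.2 ⟨i, hut.2.1, hc⟩
      refine (Finset.card_le_card hsub).trans (Finset.card_biUnion_le.trans ?_)
      calc ∑ i ∈ sats D l y, (F (i :: l) y).card ≤ ∑ i ∈ sats D l y, 2 * (d + w) := by
            refine Finset.sum_le_sum fun i hi => hF1 _ (by simpa using hv) y hy ?_
            exact ⟨hvt.1, hi, hvt.2.2⟩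
        _ = (sats D l y).card * (2 * (d + w)) := by simp
        _ ≤ 2 * (2 * (d + w)) := Nat.mul_le_mul_right _ hvt.2.2
        _ = 4 * (d + w) := by ring
    · have : G y = ∅ := by
        ext c
        simp only [G, Finset.mem_filter, Finset.mem_univ, true_and, Finset.notMem_empty, iff_false]
        rintro ⟨v, hv, hvt, _⟩
        exact h ⟨v, hv, hvt⟩
      simp [this]
  have hsub : explored w D ((Finset.range (t + 1)).biUnion Q) (t + 1) ⊆
      explored w D ((Finset.range t).biUnion Q) t ∪ (Q t).biUnion G := by
    intro c hc
    simp only [explored, Finset.mem_filter, Finset.mem_univ, true_and] at hc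
    obtain ⟨v, hv, hxy⟩ := hc
    rw [Finset.mem_union]
    rcases hF2 v hv c hxy with h | ⟨y, hy, hyt, hc⟩
    · exact Or.inl h
    · refine Or.inr (Finset.mem_biUnion.2 ⟨y, hy, ?_⟩)
      simp only [G, Finset.mem_filter, Finset.mem_univ, true_and]
      exact ⟨v, hv, hyt, hc⟩
  refine (Finset.card_le_card hsub).trans ((Finset.card_union_le _ _).trans ?_)
  refine Nat.add_le_add_left (Finset.card_biUnion_le.trans ?_) _
  refine (Finset.sum_le_sum hG).trans ?_
  simp [mul_comm]

/-- After `L` batches without large gaps, few coordinates have been explored at level `L`. -/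
theorem card_explored_le {w d L : ℕ} {D : List (Fin N) → Finset (Fin n)}
    {Q : ℕ → Finset (Cube n)} (hQ : GapsAtMost w d L D Q) {t : ℕ} (ht : t ≤ L) :
    (explored w D ((Finset.range t).biUnion Q) t).card ≤
      4 * (d + w) * ∑ i ∈ Finset.range t, (Q i).card := by
  induction t with
  | zero => simp [explored]
  | succ t ih =>
    rw [Finset.sum_range_succ, mul_add]
    exact (card_explored_succ_le hQ ht).trans (Nat.add_le_add_right (ih (by omega)) _)

end MonotonicityTesting

/-! ### Random constraints and the rarity of large gaps -/

namespace MonotonicityTesting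

variable {n N M L : ℕ}

/-- The nodes of the tree with `L` levels and `N` children of each inner node. -/
abbrev Node (N L : ℕ) : Type := {v : List (Fin N) // v.length ≤ L}

instance (N L : ℕ) : Finite (Node N L) := (List.finite_length_le (Fin N) L).to_subtype

noncomputable instance (N L : ℕ) : Fintype (Node N L) := Fintype.ofFinite _

/-- The constraints that belong to an outcome of the random choices: a coordinate is in the
constraint of the node `v` when the choice made for both is `0`. -/
def constraint (ω : Node N L → Fin n → Fin M) (v : List (Fin N)) : Finset (Fin n) :=
  Finset.univ.filter fun c => ∃ h : v.length ≤ L, (ω ⟨v, h⟩ c).val = 0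

theorem mem_constraint {ω : Node N L → Fin n → Fin M} {v : List (Fin N)} (h : v.length ≤ L)
    {c : Fin n} : c ∈ constraint ω v ↔ (ω ⟨v, h⟩ c).val = 0 := by
  simp [constraint, h]

theorem card_filter_val_ne_zero (M : ℕ) :
    (Finset.univ.filter fun a : Fin M => a.val ≠ 0).card = M - 1 := by
  cases M with
  | zero => simp
  | succ m =>
    have : (Finset.univ.filter fun a : Fin (m + 1) => a.val ≠ 0) = Finset.univ.erase 0 := by
      ext a
      simp [Fin.val_eq_zero_iff]
    rw [this]
    simp

/-- If resetting the choices at `v` on `S` leads from `B`, where none of them is `0`, into `G`, then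
`B` is much smaller than `G`. -/
theorem card_mul_pow_le {V I : Type*} [Fintype V] [DecidableEq V] [Fintype I] [DecidableEq I]
    (v : V) (S : Finset I) (B G : Finset (V → I → Fin M))
    (hB : ∀ ω ∈ B, (∀ c ∈ S, (ω v c).val ≠ 0) ∧ ∀ ω' : V → I → Fin M, (∀ u, u ≠ v → ω' u = ω u) →
      (∀ c, c ∉ S → ω' v c = ω v c) → ω' ∈ G) :
    B.card * M ^ S.card ≤ G.card * (M - 1) ^ S.card := by
  classical
  have h1 : B.card * M ^ S.card = (B ×ˢ (Finset.univ : Finset (S → Fin M))).card := by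
    simp [Finset.card_product]
  have h2 : G.card * (M - 1) ^ S.card =
      (G ×ˢ Fintype.piFinset fun _ : S => Finset.univ.filter fun a : Fin M => a.val ≠ 0).card := by
    rw [Finset.card_product, Fintype.card_piFinset, Finset.prod_const, card_filter_val_ne_zero]
    simp
  rw [h1, h2]
  -- The pair of `ω` and new choices on `S` goes to the reset outcome together with the overwritten
  -- choices, from which `ω` can be restored.
  refine Finset.card_le_card_of_injOn
    (fun p => (Function.update p.1 v fun c => if h : c ∈ S then p.2 ⟨c, h⟩ else p.1 v c,
      fun c => p.1 v c)) ?_ ?_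
  · rintro ⟨ω, φ⟩ h
    have hω : ω ∈ B := by simpa using h
    simp only [Finset.coe_product, Set.mem_prod, Finset.mem_coe, Fintype.mem_piFinset,
      Finset.mem_filter, Finset.mem_univ, true_and]
    refine ⟨(hB ω hω).2 _ ?_ ?_, fun c => (hB ω hω).1 c c.2⟩
    · intro u hu
      simp [hu]
    · intro c hc
      simp [hc]
  · rintro ⟨ω, φ⟩ h ⟨ω', φ'⟩ h' heq
    simp only [Prod.mk.injEq] at heq
    obtain ⟨e1, e2⟩ := heq
    have hv := congrFun e1 v
    simp only [Function.update_self] at hv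
    ext1
    · funext u
      by_cases hu : u = v
      · subst hu
        funext c
        by_cases hc : c ∈ S
        · exact congrFun e2 ⟨c, hc⟩
        · simpa [hc] using congrFun hv c
      · simpa [hu] using congrFun e1 u
    · funext c
      simpa using congrFun hv c

theorem card_le_pow_mul {V I : Type*} [Fintype V] [DecidableEq V] [Fintype I] [DecidableEq I]
    (hM : 0 < M) (v : V) (S : Finset I) (B G : Finset (V → I → Fin M))
    (hB : ∀ ω ∈ B, (∀ c ∈ S, (ω v c).val ≠ 0) ∧ ∀ ω' : V → I → Fin M, (∀ u, u ≠ v → ω' u = ω u) →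
      (∀ c, c ∉ S → ω' v c = ω v c) → ω' ∈ G) :
    (B.card : ℝ) ≤ (1 - 1 / (M : ℝ)) ^ S.card * G.card := by
  have h := card_mul_pow_le v S B G hB
  have hM' : (0 : ℝ) < M := by exact_mod_cast hM
  have h' : (B.card : ℝ) * (M : ℝ) ^ S.card ≤ G.card * ((M : ℝ) - 1) ^ S.card := by
    have : ((M - 1 : ℕ) : ℝ) = (M : ℝ) - 1 := by
      rw [Nat.cast_sub hM]
      simp
    rw [← this]
    exact_mod_cast h
  have e : (1 - 1 / (M : ℝ)) = ((M : ℝ) - 1) / M := by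
    field_simp
  rw [e, div_pow, div_mul_eq_mul_div, le_div_iff₀ (by positivity)]
  linarith

section Transcript

variable {w : ℕ} {g : List (Fin N) → Bool} (T : BatchAlgorithm n L)

/-- Resetting the constraint of a touched node on a set of coordinates on which all queries that
touched it agree with its polarity does not change the queries. -/
theorem transcript_eq_of_reset {ω ω' : Node N L → Fin n → Fin M} {j : Fin N} {l : List (Fin N)}
    (hl : (j :: l).length ≤ L) {S : Finset (Fin n)} {t : ℕ}
    (hS : ∀ c ∈ S, (ω ⟨j :: l, hl⟩ c).val ≠ 0)
    (hcommon : ∀ c ∈ S, ∀ z ∈ T.asked (treeFun w L (constraint ω) g) t,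
      Touch w (constraint ω) (j :: l) z → z c = polarity l)
    (h1 : ∀ u, u ≠ ⟨j :: l, hl⟩ → ω' u = ω u)
    (h2 : ∀ c, c ∉ S → ω' ⟨j :: l, hl⟩ c = ω ⟨j :: l, hl⟩ c) :
    (∀ z, (Touch w (constraint ω) (j :: l) z → ∀ c ∈ S, z c = polarity l) →
      (Touch w (constraint ω) (j :: l) z ↔ Touch w (constraint ω') (j :: l) z)) ∧
    T.asked (treeFun w L (constraint ω') g) t = T.asked (treeFun w L (constraint ω) g) t ∧
    T.batchAt (treeFun w L (constraint ω') g) t = T.batchAt (treeFun w L (constraint ω) g) t := by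
  have hD : ∀ v, v ≠ j :: l → constraint ω v = constraint ω' v := by
    intro v hv
    ext c
    by_cases hvl : v.length ≤ L
    · rw [mem_constraint hvl, mem_constraint hvl, h1 ⟨v, hvl⟩ (by simpa using hv)]
    · simp [constraint, hvl]
  have hreach : ∀ z, Reach w (constraint ω) l z ↔ Reach w (constraint ω') l z := fun z =>
    reach_congr fun v hv => hD v fun h => by simp [h] at hv
  have htouch : ∀ z, (Touch w (constraint ω) (j :: l) z → ∀ c ∈ S, z c = polarity l) →
      (Touch w (constraint ω) (j :: l) z ↔ Touch w (constraint ω') (j :: l) z) := by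
    intro z hz
    have herase : (sats (constraint ω) l z).erase j = (sats (constraint ω') l z).erase j := by
      ext i
      by_cases hi : i = j
      · simp [hi]
      · simp [hi, mem_sats, hD (i :: l) (by simpa using hi)]
    have hcard := congrArg Finset.card herase
    rw [Finset.card_erase_eq_ite, Finset.card_erase_eq_ite] at hcard
    have hsub : j ∈ sats (constraint ω') l z → j ∈ sats (constraint ω) l z := by
      rw [mem_sats, mem_sats]
      intro h c hc
      refine h c ?_
      rw [mem_constraint hl] at hc ⊢
      rw [h2 c fun hcS => hS c hcS hc]
      exact hc
    constructor
    · intro h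
      have hj' : j ∈ sats (constraint ω') l z := by
        rw [mem_sats]
        intro c hc
        by_cases hcS : c ∈ S
        · exact hz h c hcS
        · refine mem_sats.1 h.2.1 c ?_
          rw [mem_constraint hl] at hc ⊢
          rwa [h2 c hcS] at hc
      refine ⟨(hreach z).1 h.1, hj', ?_⟩
      have := h.2.2
      have := Finset.card_pos.2 ⟨j, hj'⟩
      have := Finset.card_pos.2 ⟨j, h.2.1⟩
      rw [if_pos h.2.1, if_pos hj'] at hcard
      omega
    · intro h
      have hj := hsub h.2.1
      refine ⟨(hreach z).2 h.1, hj, ?_⟩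
      have := h.2.2
      have := Finset.card_pos.2 ⟨j, hj⟩
      have := Finset.card_pos.2 ⟨j, h.2.1⟩
      rw [if_pos h.2.1, if_pos hj] at hcard
      omega
  have hagree : ∀ x ∈ T.asked (treeFun w L (constraint ω) g) t,
      treeFun w L (constraint ω) g x = treeFun w L (constraint ω') g x := by
    intro x hx
    exact treeFun_congr_tree hD (htouch x fun h c hc => hcommon c hc x hx h)
  exact ⟨htouch, (T.asked_congr t hagree).symm, (T.batchAt_congr t hagree).symm⟩

open Classical in
-- If `y` touches the node, the constraint misses the gap `S`. But resetting the constraint on `S`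
-- changes neither the queries, nor `S`, nor the fact that `x` touches the node, so this costs a
-- factor `1 - 1 / M` for each element of `S`. The right side counts only queries that touch this
-- node: a sum over the huge number of nodes then stays small.
theorem card_large_gap_le (hM : 0 < M) {d q : ℕ} (hq : ∀ f, T.queries f ≤ q) {t : ℕ} (ht : t < L)
    {j : Fin N} {l : List (Fin N)} (hl : (j :: l).length ≤ L) :
    ((Finset.univ.filter fun ω : Node N L → Fin n → Fin M =>
      ∃ x ∈ T.asked (treeFun w L (constraint ω) g) (t + 1),
      ∃ y ∈ T.batchAt (treeFun w L (constraint ω) g) t,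
        Touch w (constraint ω) (j :: l) x ∧ Touch w (constraint ω) (j :: l) y ∧
        d < (gap w (constraint ω) (T.asked (treeFun w L (constraint ω) g) t) j l x y).card).card : ℝ)
      ≤ (1 - 1 / (M : ℝ)) ^ d * ∑ ω : Node N L → Fin n → Fin M,
        (q : ℝ) * ((T.asked (treeFun w L (constraint ω) g) (t + 1)).filter
          fun x => Touch w (constraint ω) (j :: l) x).card := by
  set f : (Node N L → Fin n → Fin M) → Cube n → Bool :=
    fun ω => treeFun w L (constraint ω) g with hf
  -- Membership in `G` does not require that `y` touches the node: this is the part of the event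
  -- that resetting may destroy.
  let G : Cube n × Cube n × Finset (Fin n) → Finset (Node N L → Fin n → Fin M) := fun p =>
    Finset.univ.filter fun ω => p.1 ∈ T.asked (f ω) (t + 1) ∧
      Touch w (constraint ω) (j :: l) p.1 ∧ p.2.1 ∈ T.batchAt (f ω) t ∧
      gap w (constraint ω) (T.asked (f ω) t) j l p.1 p.2.1 = p.2.2
  let B : Cube n × Cube n × Finset (Fin n) → Finset (Node N L → Fin n → Fin M) := fun p =>
    (G p).filter fun ω => Touch w (constraint ω) (j :: l) p.2.1
  let K : Finset (Cube n × Cube n × Finset (Fin n)) := Finset.univ.filter fun p => d < p.2.2.card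
  have hρ0 : (0 : ℝ) ≤ 1 - 1 / (M : ℝ) := by
    have : (1 : ℝ) ≤ M := by exact_mod_cast hM
    rw [sub_nonneg, div_le_one (by linarith)]
    exact this
  have hρ1 : 1 - 1 / (M : ℝ) ≤ 1 := by
    have : (0 : ℝ) ≤ 1 / (M : ℝ) := by positivity
    linarith
  have hBG : ∀ p ∈ K, ((B p).card : ℝ) ≤ (1 - 1 / (M : ℝ)) ^ d * (G p).card := by
    rintro ⟨x, y, S⟩ hp
    have hp : d < S.card := by simpa [K] using hp
    refine (card_le_pow_mul hM ⟨j :: l, hl⟩ S _ (G (x, y, S)) ?_).trans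
      (mul_le_mul_of_nonneg_right (pow_le_pow_of_le_one hρ0 hρ1 hp.le) (Nat.cast_nonneg _))
    intro ω hω
    simp only [B, G, Finset.mem_filter, Finset.mem_univ, true_and] at hω
    obtain ⟨⟨hx, hxt, hy, hgap⟩, hyt⟩ := hω
    have hmem : ∀ c ∈ S, (∀ z ∈ T.asked (f ω) t, Touch w (constraint ω) (j :: l) z →
        z c = polarity l) ∧ x c = polarity l ∧ y c ≠ polarity l := by
      intro c hc
      rw [← hgap] at hc
      simpa [gap] using hc
    have hS : ∀ c ∈ S, (ω ⟨j :: l, hl⟩ c).val ≠ 0 := fun c hc h0 =>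
      (hmem c hc).2.2 (mem_sats.1 hyt.2.1 c ((mem_constraint hl).2 h0))
    refine ⟨hS, fun ω' h1 h2 => ?_⟩
    obtain ⟨htouch, hasked, hbatch⟩ := transcript_eq_of_reset (w := w) (g := g) T hl hS
      (fun c hc => (hmem c hc).1) h1 h2
    simp only [G, Finset.mem_filter, Finset.mem_univ, true_and]
    refine ⟨?_, (htouch x fun _ c hc => (hmem c hc).2.1).1 hxt, ?_, ?_⟩
    · rw [BatchAlgorithm.mem_asked_succ] at hx ⊢
      exact hx.imp (fun h => hasked.symm ▸ h) fun h => hbatch.symm ▸ h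
    · exact hbatch.symm ▸ hy
    · rw [← hgap]
      unfold gap
      have hasked' : T.asked (f ω') t = T.asked (f ω) t := hasked
      rw [hasked']
      refine Finset.filter_congr fun c _ => and_congr_left' ?_
      refine forall₂_congr fun z hz => ?_
      rw [htouch z fun hzt c hc => (hmem c hc).1 z hz hzt]
  have hcover : (Finset.univ.filter fun ω : Node N L → Fin n → Fin M =>
      ∃ x ∈ T.asked (f ω) (t + 1), ∃ y ∈ T.batchAt (f ω) t,
        Touch w (constraint ω) (j :: l) x ∧ Touch w (constraint ω) (j :: l) y ∧
        d < (gap w (constraint ω) (T.asked (f ω) t) j l x y).card) ⊆ K.biUnion B := by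
    intro ω hω
    simp only [Finset.mem_filter, Finset.mem_univ, true_and] at hω
    obtain ⟨x, hx, y, hy, hxt, hyt, hd⟩ := hω
    refine Finset.mem_biUnion.2 ⟨(x, y, gap w (constraint ω) (T.asked (f ω) t) j l x y), ?_, ?_⟩
    · simpa [K] using hd
    · simp only [B, G, Finset.mem_filter, Finset.mem_univ, true_and]
      exact ⟨⟨hx, hxt, hy, trivial⟩, hyt⟩
  have hsum : (∑ p ∈ K, ((G p).card : ℝ)) ≤ ∑ ω : Node N L → Fin n → Fin M,
        (q : ℝ) * ((T.asked (f ω) (t + 1)).filter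
          fun x => Touch w (constraint ω) (j :: l) x).card := by
    have h1 : ∀ p, ((G p).card : ℝ) = ∑ ω, if ω ∈ G p then (1 : ℝ) else 0 := by
      intro p
      simp
    simp_rw [h1]
    rw [Finset.sum_comm]
    refine Finset.sum_le_sum fun ω _ => ?_
    rw [Finset.sum_boole]
    -- For a fixed outcome, `x` and `y` determine the gap, so only pairs need to be counted.
    have h2 : (K.filter fun p => ω ∈ G p).card ≤ (((T.asked (f ω) (t + 1)).filter
        fun x => Touch w (constraint ω) (j :: l) x) ×ˢ T.batchAt (f ω) t).card := by
      refine Finset.card_le_card_of_injOn (fun p => (p.1, p.2.1)) ?_ ?_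
      · rintro ⟨x, y, S⟩ hp
        simp only [G, Finset.coe_filter, Finset.mem_filter, Finset.mem_univ, true_and,
          Set.mem_ofPred_eq] at hp
        simp only [Finset.coe_product, Set.mem_prod, Finset.mem_coe, Finset.mem_filter]
        exact ⟨⟨hp.2.1, hp.2.2.1⟩, hp.2.2.2.1⟩
      · rintro ⟨x, y, S⟩ hp ⟨x', y', S'⟩ hp' heq
        simp only [G, Finset.coe_filter, Finset.mem_filter, Finset.mem_univ, true_and,
          Set.mem_ofPred_eq] at hp hp'
        simp only [Prod.mk.injEq] at heq
        obtain ⟨rfl, rfl⟩ := heq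
        rw [← hp.2.2.2.2, ← hp'.2.2.2.2]
    rw [Finset.card_product, mul_comm] at h2
    have h3 := h2.trans (Nat.mul_le_mul_right _ ((T.card_batchAt_le (f ω) ht).trans (hq _)))
    exact_mod_cast h3
  calc _ ≤ ((K.biUnion B).card : ℝ) := by exact_mod_cast Finset.card_le_card hcover
    _ ≤ ∑ p ∈ K, ((B p).card : ℝ) := by exact_mod_cast Finset.card_biUnion_le
    _ ≤ ∑ p ∈ K, (1 - 1 / (M : ℝ)) ^ d * ((G p).card : ℝ) := Finset.sum_le_sum hBG
    _ = (1 - 1 / (M : ℝ)) ^ d * ∑ p ∈ K, ((G p).card : ℝ) := by rw [Finset.mul_sum]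
    _ ≤ _ := mul_le_mul_of_nonneg_left hsum (pow_nonneg hρ0 _)

/-- On each level the parent of a touched node is unique, and at most two of its children are
touched. This replaces a union bound over all nodes. -/
theorem card_touch_le (D : List (Fin N) → Finset (Fin n)) (x : Cube n)
    [∀ v, Decidable (Touch w D v x)] :
    (Finset.univ.filter fun v : Node N L => v.1 ≠ [] ∧ Touch w D v.1 x).card ≤ 2 * L := by
  classical
  have hsub : (Finset.univ.filter fun v : Node N L => v.1 ≠ [] ∧ Touch w D v.1 x) ⊆
      (Finset.range L).biUnion fun t =>
        Finset.univ.filter fun v : Node N L => v.1.length = t + 1 ∧ Touch w D v.1 x := by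
    rintro ⟨v, hv⟩ h
    simp only [Finset.mem_filter, Finset.mem_univ, true_and] at h
    obtain ⟨j, l, rfl⟩ := List.exists_cons_of_ne_nil h.1
    refine Finset.mem_biUnion.2 ⟨l.length, by simpa using hv, ?_⟩
    simpa using h.2
  refine (Finset.card_le_card hsub).trans (Finset.card_biUnion_le.trans ?_)
  have hlevel : ∀ t ∈ Finset.range L, (Finset.univ.filter fun v : Node N L =>
      v.1.length = t + 1 ∧ Touch w D v.1 x).card ≤ 2 := by
    intro t _
    by_cases h : ∃ v : Node N L, v.1.length = t + 1 ∧ Touch w D v.1 x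
    · obtain ⟨⟨v, hvL⟩, hv, hvt⟩ := h
      obtain ⟨j, l, rfl⟩ := List.exists_cons_of_length_eq_add_one hv
      have hlen : l.length = t := by simpa using hv
      have himage : ((Finset.univ.filter fun v : Node N L =>
          v.1.length = t + 1 ∧ Touch w D v.1 x).image Subtype.val) ⊆
          (sats D l x).image fun i => i :: l := by
        intro u hu
        simp only [Finset.mem_image, Finset.mem_filter, Finset.mem_univ, true_and] at hu
        obtain ⟨⟨u, huL⟩, ⟨hu, hut⟩, rfl⟩ := hu
        obtain ⟨i, m, rfl⟩ := List.exists_cons_of_length_eq_add_one hu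
        obtain rfl : m = l := hut.1.unique hvt.1 (by
          simp only [List.length_cons] at hu
          omega)
        exact Finset.mem_image.2 ⟨i, hut.2.1, rfl⟩
      rw [← Finset.card_image_of_injective _ Subtype.val_injective]
      exact (Finset.card_le_card himage).trans (Finset.card_image_le.trans hvt.2.2)
    · rw [Finset.filter_false_of_mem fun v _ hv => h ⟨v, hv⟩]
      simp
  refine (Finset.sum_le_sum hlevel).trans ?_
  simp [mul_comm]

open Classical in
/-- Large gaps are rare. -/
theorem card_not_gapsAtMost_le (hM : 0 < M) {d q : ℕ} (hq : ∀ f, T.queries f ≤ q) :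
    ((Finset.univ.filter fun ω : Node N L → Fin n → Fin M =>
      ¬ GapsAtMost w d L (constraint ω) (T.batchAt (treeFun w L (constraint ω) g))).card : ℝ) ≤
      (1 - 1 / (M : ℝ)) ^ d * (2 * L ^ 2 * q ^ 2) *
        Fintype.card (Node N L → Fin n → Fin M) := by
  set f : (Node N L → Fin n → Fin M) → Cube n → Bool :=
    fun ω => treeFun w L (constraint ω) g with hf
  have hρ0 : (0 : ℝ) ≤ 1 - 1 / (M : ℝ) := by
    have : (1 : ℝ) ≤ M := by exact_mod_cast hM
    rw [sub_nonneg, div_le_one (by linarith)]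
    exact this
  let B : ℕ → Node N L → Finset (Node N L → Fin n → Fin M) := fun t v =>
    Finset.univ.filter fun ω => ∃ j l, v.1 = j :: l ∧ ∃ x ∈ T.asked (f ω) (t + 1),
      ∃ y ∈ T.batchAt (f ω) t, Touch w (constraint ω) (j :: l) x ∧
        Touch w (constraint ω) (j :: l) y ∧
        d < (gap w (constraint ω) (T.asked (f ω) t) j l x y).card
  have hcover : (Finset.univ.filter fun ω : Node N L → Fin n → Fin M =>
      ¬ GapsAtMost w d L (constraint ω) (T.batchAt (f ω))) ⊆
      (Finset.range L).biUnion fun t => Finset.univ.biUnion fun v => B t v := by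
    intro ω hω
    replace hω := (Finset.mem_filter.1 hω).2
    unfold GapsAtMost at hω
    push Not at hω
    obtain ⟨t, ht, j, l, hl, x, hx, y, hy, hxt, hyt, hd⟩ := hω
    refine Finset.mem_biUnion.2 ⟨t, Finset.mem_range.2 ht, Finset.mem_biUnion.2
      ⟨⟨j :: l, by simp; omega⟩, Finset.mem_univ _, ?_⟩⟩
    simp only [B, Finset.mem_filter, Finset.mem_univ, true_and]
    exact ⟨j, l, rfl, x, hx, y, hy, hxt, hyt, hd⟩
  have hB : ∀ t ∈ Finset.range L, ∀ v, ((B t v).card : ℝ) ≤ (1 - 1 / (M : ℝ)) ^ d *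
      ∑ ω : Node N L → Fin n → Fin M, (q : ℝ) * ∑ x ∈ T.asked (f ω) (t + 1),
        if v.1 ≠ [] ∧ Touch w (constraint ω) v.1 x then (1 : ℝ) else 0 := by
    rintro t ht ⟨v, hv⟩
    cases v with
    | nil => simp [B]
    | cons j l =>
      have h := card_large_gap_le (w := w) (g := g) (d := d) T hM hq (Finset.mem_range.1 ht) hv
      simp only [B, List.cons.injEq]
      convert h using 3
      · ext ω
        simp only [Finset.mem_filter, Finset.mem_univ, true_and]
        constructor
        · rintro ⟨_, _, ⟨rfl, rfl⟩, h⟩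
          exact h
        · exact fun h => ⟨_, _, ⟨rfl, rfl⟩, h⟩
      · simp [f]
  have hsum : ∀ t ∈ Finset.range L, ∑ v, ((B t v).card : ℝ) ≤ (1 - 1 / (M : ℝ)) ^ d *
      (Fintype.card (Node N L → Fin n → Fin M) * (q * (q * (2 * L)))) := by
    intro t ht
    refine (Finset.sum_le_sum fun v _ => hB t ht v).trans ?_
    rw [← Finset.mul_sum]
    refine mul_le_mul_of_nonneg_left ?_ (pow_nonneg hρ0 _)
    rw [Finset.sum_comm]
    have hω : ∀ ω ∈ (Finset.univ : Finset (Node N L → Fin n → Fin M)),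
        ∑ v : Node N L, (q : ℝ) * ∑ x ∈ T.asked (f ω) (t + 1),
          (if v.1 ≠ [] ∧ Touch w (constraint ω) v.1 x then (1 : ℝ) else 0) ≤
        q * (q * (2 * L)) := by
      intro ω _
      rw [← Finset.mul_sum]
      refine mul_le_mul_of_nonneg_left ?_ (Nat.cast_nonneg _)
      rw [Finset.sum_comm]
      have hx : ∀ x ∈ T.asked (f ω) (t + 1), (∑ v : Node N L,
          if v.1 ≠ [] ∧ Touch w (constraint ω) v.1 x then (1 : ℝ) else 0) ≤ 2 * L := by
        intro x _
        rw [Finset.sum_boole]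
        exact_mod_cast card_touch_le (L := L) (constraint ω) x
      refine (Finset.sum_le_sum hx).trans ?_
      rw [Finset.sum_const, nsmul_eq_mul]
      refine mul_le_mul_of_nonneg_right ?_ (by positivity)
      exact_mod_cast (T.card_asked_le (f ω) (Finset.mem_range.1 ht)).trans (hq _)
    refine (Finset.sum_le_sum hω).trans ?_
    rw [Finset.sum_const, nsmul_eq_mul, Finset.card_univ]
  calc _ ≤ (((Finset.range L).biUnion fun t => Finset.univ.biUnion fun v => B t v).card : ℝ) := by
        exact_mod_cast Finset.card_le_card hcover
    _ ≤ ∑ t ∈ Finset.range L, ∑ v, ((B t v).card : ℝ) := by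
        exact_mod_cast Finset.card_biUnion_le.trans
          (Finset.sum_le_sum fun t _ => Finset.card_biUnion_le)
    _ ≤ ∑ t ∈ Finset.range L, (1 - 1 / (M : ℝ)) ^ d *
      (Fintype.card (Node N L → Fin n → Fin M) * (q * (q * (2 * L)))) := Finset.sum_le_sum hsum
    _ = _ := by
        rw [Finset.sum_const, nsmul_eq_mul, Finset.card_range]
        ring

end Transcript

end MonotonicityTesting

/-! ### Coupling constant leaves with parity leaves -/

namespace MonotonicityTesting

variable {n N L : ℕ}

/-- Extend an assignment of bits to the nodes by `false`. -/
def extendLeaf (s : Node N L → Bool) (u : List (Fin N)) : Bool :=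
  if h : u.length ≤ L then s ⟨u, h⟩ else false

/-- The monotone function with constant values on the leaves. -/
def constFun (w : ℕ) (D : List (Fin N) → Finset (Fin n)) (s : Node N L → Bool) (x : Cube n) :
    Bool :=
  treeFun w L D (extendLeaf s) x

/-- The function whose value on a leaf is the constant, plus the parity of the coordinates `a` and
`b`. -/
def parityFun (w : ℕ) (D : List (Fin N) → Finset (Fin n)) (a b : Fin n) (s : Node N L → Bool)
    (x : Cube n) : Bool :=
  treeFun w L D (fun u => xor (extendLeaf s u) (xor (x a) (x b))) x

theorem constFun_monotone (w : ℕ) (D : List (Fin N) → Finset (Fin n)) (s : Node N L → Bool) :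
    Monotone (constFun w D s) :=
  treeFun_monotone w L D _

open Classical in
/-- Add to the leaf values the parities that the queries see on the leaves. -/
noncomputable def shiftLeaf (w : ℕ) (D : List (Fin N) → Finset (Fin n)) (a b : Fin n)
    (A : Finset (Cube n)) (s : Node N L → Bool) (v : Node N L) : Bool :=
  xor (s v) (decide (∃ x ∈ A, Reach w D v.1 x ∧ xor (x a) (x b) = true))

theorem shiftLeaf_injective (w : ℕ) (D : List (Fin N) → Finset (Fin n)) (a b : Fin n)
    (A : Finset (Cube n)) :
    Function.Injective (shiftLeaf w D a b A : (Node N L → Bool) → Node N L → Bool) := by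
  intro s s' h
  funext v
  have := congrFun h v
  simpa [shiftLeaf] using this

open Classical in
-- As `a` and `b` are unexplored, all queries in a leaf see the same parity, and the shift of the
-- leaf bit cancels it.
theorem parityFun_shiftLeaf {w : ℕ} {D : List (Fin N) → Finset (Fin n)} {a b : Fin n}
    {A : Finset (Cube n)} (ha : a ∉ explored w D A L) (hb : b ∉ explored w D A L)
    (s : Node N L → Bool) {x : Cube n} (hx : x ∈ A) :
    parityFun w D a b (shiftLeaf w D a b A s) x = constFun w D s x := by
  refine treeFun_congr_leaf fun u hu hr => ?_
  simp only [explored, Finset.mem_filter, Finset.mem_univ, true_and] at ha hb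
  push Not at ha hb
  have key : decide (∃ y ∈ A, Reach w D u y ∧ xor (y a) (y b) = true) = xor (x a) (x b) := by
    by_cases h : xor (x a) (x b) = true
    · rw [h, decide_eq_true_iff]
      exact ⟨x, hx, hr, h⟩
    · rw [Bool.eq_false_of_not_eq_true h, decide_eq_false_iff_not]
      rintro ⟨y, hy, hyr, hy1⟩
      rw [ha u hu y hy x hx hyr.touch hr.touch, hb u hu y hy x hx hyr.touch hr.touch] at hy1
      exact h hy1
  simp only [extendLeaf, hu.le, dite_true, shiftLeaf, key]
  cases s ⟨u, hu.le⟩ <;> cases xor (x a) (x b) <;> rfl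

open Classical in
/-- An algorithm tells the two functions apart only if its queries on some leaf differ in one of the
coordinates `a` and `b`. -/
theorem card_run_constFun_le (w : ℕ) (D : List (Fin N) → Finset (Fin n)) (a b : Fin n)
    (T : BatchAlgorithm n L) :
    (Finset.univ.filter fun s : Node N L → Bool => T.run (constFun w D s) = true).card ≤
      (Finset.univ.filter fun s : Node N L → Bool => T.run (parityFun w D a b s) = true).card +
      (Finset.univ.filter fun s : Node N L → Bool =>
        a ∈ explored w D (T.asked (constFun w D s) L) L ∨
        b ∈ explored w D (T.asked (constFun w D s) L) L).card := by
  set hit : (Node N L → Bool) → Prop := fun s =>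
    a ∈ explored w D (T.asked (constFun w D s) L) L ∨
      b ∈ explored w D (T.asked (constFun w D s) L) L with hhit
  let φ : (Node N L → Bool) → Node N L → Bool := fun s =>
    shiftLeaf w D a b (T.asked (constFun w D s) L) s
  have hagree : ∀ s, ¬ hit s → ∀ x ∈ T.asked (constFun w D s) L,
      constFun w D s x = parityFun w D a b (φ s) x := by
    intro s hs x hx
    simp only [hhit, not_or] at hs
    exact (parityFun_shiftLeaf hs.1 hs.2 s hx).symm
  rw [← Finset.card_filter_add_card_filter_not hit
    (s := Finset.univ.filter fun s : Node N L → Bool => T.run (constFun w D s) = true), add_comm]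
  refine Nat.add_le_add ?_ (Finset.card_le_card ?_)
  · refine Finset.card_le_card_of_injOn φ ?_ ?_
    · intro s hs
      simp only [Finset.coe_filter, Finset.mem_filter, Finset.mem_univ, true_and,
        Set.mem_ofPred_eq] at hs ⊢
      rw [← T.run_congr (hagree s hs.2)]
      exact hs.1
    · intro s hs s' hs' heq
      simp only [Finset.coe_filter, Finset.mem_filter, Finset.mem_univ, true_and,
        Set.mem_ofPred_eq] at hs hs'
      -- The shift depends on `s` through the queries, but the answers are preserved, so `φ s`
      -- determines the queries and hence the shift.
      have h1 := T.asked_congr L (hagree s hs.2)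
      have h2 := T.asked_congr L (hagree s' hs'.2)
      rw [heq, ← h2] at h1
      refine shiftLeaf_injective w D a b (T.asked (constFun w D s) L) ?_
      change φ s = _
      rw [heq, h1]
  · intro s hs
    simp only [Finset.mem_filter, Finset.mem_univ, true_and] at hs ⊢
    exact hs.2

end MonotonicityTesting

/-! ### Distance of the parity functions from monotone -/

namespace MonotonicityTesting

variable {n N L : ℕ}

/-- The point that agrees with `x` except on the coordinates `a` and `b`, where it has the values
`α` and `β`. -/
def square (a b : Fin n) (x : Cube n) (α β : Bool) : Cube n :=
  Function.update (Function.update x a α) b β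

/-- All four points that differ from `x` at most in the coordinates `a` and `b` are in one leaf. -/
def SquareInLeaf (w L : ℕ) (D : List (Fin N) → Finset (Fin n)) (a b : Fin n) (x : Cube n) : Prop :=
  ∃ u : List (Fin N), u.length = L ∧ ∀ α β, Reach w D u (square a b x α β)

theorem parityFun_square {w : ℕ} {D : List (Fin N) → Finset (Fin n)} {a b : Fin n} (hab : a ≠ b)
    {x : Cube n} {u : List (Fin N)} (hu : u.length = L) (s : Node N L → Bool) {α β : Bool}
    (h : Reach w D u (square a b x α β)) :
    parityFun w D a b s (square a b x α β) = xor (extendLeaf s u) (xor α β) := by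
  rw [parityFun, treeFun_of_reach h hu]
  simp [square, hab]

theorem square_mono {a b : Fin n} {x : Cube n} {α β α' β' : Bool} (h : α ≤ α') (h' : β ≤ β') :
    square a b x α β ≤ square a b x α' β' := by
  intro c
  simp only [square, Function.update_apply]
  split_ifs
  · exact h'
  · exact h
  · exact le_rfl

/-- The parity of two bits both increases and decreases along edges of the square, and so does its
negation. -/
theorem exists_ne_on_square {w : ℕ} {D : List (Fin N) → Finset (Fin n)} {a b : Fin n}
    (hab : a ≠ b) {x : Cube n} (h : SquareInLeaf w L D a b x) (s : Node N L → Bool)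
    {g : Cube n → Bool} (hg : Monotone g) :
    ∃ α β, parityFun w D a b s (square a b x α β) ≠ g (square a b x α β) := by
  obtain ⟨u, hu, hr⟩ := h
  by_contra hcon
  push Not at hcon
  have e : ∀ α β, g (square a b x α β) = xor (extendLeaf s u) (xor α β) := fun α β => by
    rw [← hcon, parityFun_square hab hu s (hr α β)]
  have h1 := hg (square_mono (a := a) (b := b) (x := x) (Bool.false_le true) (le_refl false))
  have h2 := hg (square_mono (a := a) (b := b) (x := x) (le_refl true) (Bool.false_le true))
  rw [e, e] at h1 h2
  revert h1 h2
  cases extendLeaf s u <;> decide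

open Classical in
-- A point of disagreement in the square of `x` determines `x` up to its values at `a` and `b`,
-- hence the factor `4`.
theorem card_squareInLeaf_le {w : ℕ} {D : List (Fin N) → Finset (Fin n)} {a b : Fin n}
    (hab : a ≠ b) (s : Node N L → Bool) {g : Cube n → Bool} (hg : Monotone g) :
    (Finset.univ.filter fun x => SquareInLeaf w L D a b x).card ≤
      4 * hammingDist (parityFun w D a b s) g := by
  choose! α β hαβ using fun x (h : SquareInLeaf w L D a b x) => exists_ne_on_square hab h s hg
  refine Finset.card_le_mul_card_image_of_maps_to (f := fun x => square a b x (α x) (β x))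
    (t := Finset.univ.filter fun x => parityFun w D a b s x ≠ g x) ?_ 4 ?_
  · intro x hx
    simp only [Finset.mem_filter, Finset.mem_univ, true_and] at hx ⊢
    exact hαβ x hx
  · intro y _
    calc _ ≤ ((Finset.univ : Finset (Bool × Bool)).image fun p => square a b y p.1 p.2).card := by
          refine Finset.card_le_card fun x hx => ?_
          simp only [Finset.mem_filter, Finset.mem_univ, true_and] at hx
          refine Finset.mem_image.2 ⟨(x a, x b), Finset.mem_univ _, ?_⟩
          rw [← hx.2]
          funext c
          simp only [square, Function.update_apply]
          split_ifs with h1 h2 <;> simp [*]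
      _ ≤ 4 := Finset.card_image_le.trans (by simp)

end MonotonicityTesting

/-! ### Probability that a square lies in one leaf -/

namespace MonotonicityTesting

variable {n N M L : ℕ}

/-- The number of coordinates of `y` with a value other than `p`. -/
def countNe (p : Bool) (y : Cube n) : ℕ := (Finset.univ.filter fun c => y c ≠ p).card

theorem countNe_of_isMiddle {w : ℕ} {y : Cube n} (h : IsMiddle w y) (p : Bool) :
    n ≤ 2 * countNe p y + 2 * w ∧ 2 * countNe p y ≤ n + 2 * w := by
  have h1 : weight y + countNe true y = n := by
    have := Finset.card_filter_add_card_filter_not (s := Finset.univ) fun c => y c = true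
    simpa [weight, countNe] using this
  have h2 : countNe false y = weight y := by simp [weight, countNe]
  have := h.1
  have := h.2
  cases p <;> omega

/-- The choices for a node that make `y` satisfy its constraint with polarity `p`. -/
def agreeSet (M : ℕ) (p : Bool) (y : Cube n) : Finset (Fin n → Fin M) :=
  Finset.univ.filter fun τ => ∀ c, (τ c).val = 0 → y c = p

theorem card_agreeSet (hM : 0 < M) (p : Bool) (y : Cube n) :
    ((agreeSet M p y).card : ℝ) = (1 - 1 / (M : ℝ)) ^ countNe p y * (M : ℝ) ^ n := by
  have h : agreeSet M p y = Fintype.piFinset fun c =>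
      if y c = p then Finset.univ else Finset.univ.filter fun a : Fin M => a.val ≠ 0 := by
    ext τ
    simp only [agreeSet, Finset.mem_filter, Finset.mem_univ, true_and, Fintype.mem_piFinset]
    refine forall_congr' fun c => ?_
    split_ifs with hc
    · simp [hc]
    · simp [hc]
  have hM' : (M : ℝ) ≠ 0 := by exact_mod_cast hM.ne'
  have hone : ∀ c, (((if y c = p then Finset.univ else
      Finset.univ.filter fun a : Fin M => a.val ≠ 0 : Finset (Fin M)).card : ℕ) : ℝ) =
      (if y c ≠ p then 1 - 1 / (M : ℝ) else 1) * M := by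
    intro c
    by_cases hc : y c = p
    · simp [hc]
    · rw [if_neg hc, if_pos hc, card_filter_val_ne_zero, Nat.cast_sub hM]
      field_simp
      simp
  rw [h, Fintype.card_piFinset, Nat.cast_prod]
  simp_rw [hone]
  rw [Finset.prod_mul_distrib, Finset.prod_ite]
  simp [countNe]

/-- The part of the random choices that puts the square of `x` into the leaf `u`. -/
def leafBox (M : ℕ) (a b : Fin n) (x : Cube n) : List (Fin N) → List (Fin N) →
    Finset (Fin n → Fin M)
  | [], _ => Finset.univ
  | i :: u, v =>
    if v = i :: u then agreeSet M (polarity u) (square a b x (!polarity u) (!polarity u))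
    -- Since `[].tail = []`, the root would otherwise count as a sibling of the nodes on the first
    -- level.
    else if v ≠ [] ∧ v.tail = u then
      (agreeSet M (polarity u) (square a b x (polarity u) (polarity u)))ᶜ
    else leafBox M a b x u v

/-- The box of `u` restricts no node deeper than `u`, so the conditions for the next level fall on
fresh constraints. -/
theorem leafBox_of_length_lt (a b : Fin n) (x : Cube n) {u v : List (Fin N)}
    (h : u.length < v.length) : leafBox M a b x u v = Finset.univ := by
  induction u with
  | nil => rfl
  | cons i u ih =>
    have h1 : v ≠ i :: u := fun e => by simp [e] at h
    have h2 : ¬ (v ≠ [] ∧ v.tail = u) := by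
      rintro ⟨-, e⟩
      have := congrArg List.length e
      simp only [List.length_tail, List.length_cons] at this h
      omega
    rw [leafBox, if_neg h1, if_neg h2]
    exact ih (by simp at h; omega)

/-- The corner with values `!p` is the hardest one for polarity `p`: if it satisfies a constraint,
all four corners do. Dually, the corner with values `p` is the easiest one, and if it fails, all
four fail. -/
theorem square_eq_of_extreme {a b c : Fin n} {x : Cube n} {p : Bool}
    (h : square a b x (!p) (!p) c = p) (α β : Bool) : square a b x α β c = p := by
  simp only [square, Function.update_apply] at h ⊢
  split_ifs at h ⊢ <;> simp_all

theorem square_ne_of_extreme {a b c : Fin n} {x : Cube n} {p : Bool}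
    (h : square a b x p p c ≠ p) (α β : Bool) : square a b x α β c ≠ p := by
  simp only [square, Function.update_apply] at h ⊢
  split_ifs at h ⊢ <;> simp_all

theorem isMiddle_square {w : ℕ} {a b : Fin n} {x : Cube n}
    (hlo : IsMiddle w (square a b x false false)) (hhi : IsMiddle w (square a b x true true))
    (α β : Bool) : IsMiddle w (square a b x α β) := by
  have h1 := weight_mono (square_mono (a := a) (b := b) (x := x) (Bool.false_le α) (Bool.false_le β))
  have h2 := weight_mono (square_mono (a := a) (b := b) (x := x) (Bool.le_true α) (Bool.le_true β))
  have := hlo.1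
  have := hhi.2
  constructor <;> omega

theorem reach_of_mem_leafBox {w : ℕ} {a b : Fin n} {x : Cube n}
    (hlo : IsMiddle w (square a b x false false)) (hhi : IsMiddle w (square a b x true true))
    {ω : Node N L → Fin n → Fin M} {u : List (Fin N)} (hu : u.length ≤ L)
    (h : ∀ v : Node N L, ω v ∈ leafBox M a b x u v.1) (α β : Bool) :
    Reach w (constraint ω) u (square a b x α β) := by
  induction u with
  | nil => exact isMiddle_square hlo hhi α β
  | cons i u ih =>
    have hu' : u.length ≤ L := by simp at hu; omega
    refine ⟨ih hu' fun v => ?_, ?_⟩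
    · have hv := h v
      rw [leafBox] at hv
      split_ifs at hv with h1 h2
      · rw [leafBox_of_length_lt]
        · exact Finset.mem_univ _
        · simp [h1]
      · rw [leafBox_of_length_lt]
        · exact Finset.mem_univ _
        · have := List.length_pos_iff.2 h2.1
          rw [← h2.2, List.length_tail]
          omega
      · exact hv
    · ext j
      have hj : (j :: u).length ≤ L := hu
      rw [mem_sats, Finset.mem_singleton]
      have hv := h ⟨j :: u, hj⟩
      by_cases hji : j = i
      · subst hji
        simp only [leafBox, if_true, agreeSet, Finset.mem_filter, Finset.mem_univ, true_and] at hv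
        refine iff_of_true (fun c hc => ?_) rfl
        exact square_eq_of_extreme (hv c ((mem_constraint hj).1 hc)) α β
      · refine iff_of_false (fun hall => ?_) hji
        rw [leafBox, if_neg (by simpa using hji), if_pos (by simp)] at hv
        simp only [agreeSet, Finset.mem_compl, Finset.mem_filter, Finset.mem_univ, true_and] at hv
        push Not at hv
        obtain ⟨c, hc, hne⟩ := hv
        exact square_ne_of_extreme hne α β (hall c ((mem_constraint hj).2 hc))

/-- Each level contributes independent factors: the chosen child is satisfied by the hardest corner,
and its `N - 1` siblings are violated by the easiest one. Both corners are in the middle layers, so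
`h` applies to their counts. -/
theorem card_leafBox_le (hM : 0 < M) {w : ℕ} {a b : Fin n} {x : Cube n}
    (hlo : IsMiddle w (square a b x false false)) (hhi : IsMiddle w (square a b x true true))
    {κ : ℝ} (hκ : 0 ≤ κ)
    (h : ∀ z z' : ℕ, n ≤ 2 * z + 2 * w → 2 * z ≤ n + 2 * w → n ≤ 2 * z' + 2 * w →
      2 * z' ≤ n + 2 * w →
      κ ≤ (1 - 1 / (M : ℝ)) ^ z * (1 - (1 - 1 / (M : ℝ)) ^ z') ^ (N - 1))
    {u : List (Fin N)} (hu : u.length ≤ L) :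
    κ ^ u.length ≤ ∏ v : Node N L, ((leafBox M a b x u v.1).card : ℝ) / (M : ℝ) ^ n := by
  classical
  have hM' : (M : ℝ) ^ n ≠ 0 := by
    have : (M : ℝ) ≠ 0 := by exact_mod_cast hM.ne'
    positivity
  have huniv : ((Finset.univ : Finset (Fin n → Fin M)).card : ℝ) / (M : ℝ) ^ n = 1 := by
    rw [Finset.card_univ, Fintype.card_fun, Fintype.card_fin, Fintype.card_fin, Nat.cast_pow,
      div_self hM']
  induction u with
  | nil => simp only [leafBox, huniv]; simp
  | cons i u ih =>
    have hu' : u.length ≤ L := by simp at hu; omega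
    set p := polarity u with hp
    have hgood : ((agreeSet M p (square a b x (!p) (!p))).card : ℝ) / (M : ℝ) ^ n =
        (1 - 1 / (M : ℝ)) ^ countNe p (square a b x (!p) (!p)) := by
      rw [card_agreeSet hM, mul_div_assoc, div_self hM', mul_one]
    have havoid : (((agreeSet M p (square a b x p p))ᶜ.card : ℕ) : ℝ) / (M : ℝ) ^ n =
        1 - (1 - 1 / (M : ℝ)) ^ countNe p (square a b x p p) := by
      rw [Finset.card_compl, Nat.cast_sub (Finset.card_le_univ _), sub_div, card_agreeSet hM,
        mul_div_assoc, div_self hM', mul_one, ← huniv, Finset.card_univ]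
    let F : Fin N → ℝ := fun j => if j = i then
      (1 - 1 / (M : ℝ)) ^ countNe p (square a b x (!p) (!p)) else
      1 - (1 - 1 / (M : ℝ)) ^ countNe p (square a b x p p)
    let child : Fin N → Node N L := fun j => ⟨j :: u, hu⟩
    have hinj : Function.Injective child := fun j k hjk => by
      simpa [child] using hjk
    have hF : ∏ j, F j = (1 - 1 / (M : ℝ)) ^ countNe p (square a b x (!p) (!p)) *
        (1 - (1 - 1 / (M : ℝ)) ^ countNe p (square a b x p p)) ^ (N - 1) := by
      rw [← Finset.mul_prod_erase _ _ (Finset.mem_univ i)]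
      congr 1
      · simp [F]
      · rw [Finset.prod_congr rfl fun j hj => if_neg (Finset.ne_of_mem_erase hj)]
        simp
    have hsplit : ∏ v : Node N L, ((leafBox M a b x (i :: u) v.1).card : ℝ) / (M : ℝ) ^ n =
        (∏ v : Node N L, ((leafBox M a b x u v.1).card : ℝ) / (M : ℝ) ^ n) * ∏ j, F j := by
      rw [← Finset.prod_mul_prod_compl (Finset.univ.image child),
        ← Finset.prod_mul_prod_compl (Finset.univ.image child)
          (fun v : Node N L => ((leafBox M a b x u v.1).card : ℝ) / (M : ℝ) ^ n),
        Finset.prod_image hinj.injOn, Finset.prod_image hinj.injOn]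
      have e1 : ∀ j, ((leafBox M a b x u (child j).1).card : ℝ) / (M : ℝ) ^ n = 1 := fun j => by
        rw [leafBox_of_length_lt a b x (by simp [child]), huniv]
      have e2 : ∀ j, ((leafBox M a b x (i :: u) (child j).1).card : ℝ) / (M : ℝ) ^ n = F j := by
        intro j
        simp only [child, leafBox, F]
        by_cases hji : j = i
        · rw [if_pos (by rw [hji]), if_pos hji, ← hgood]
        · rw [if_neg (by simpa using hji), if_pos (by simp), if_neg hji, ← havoid]
      have e3 : ∀ v ∈ (Finset.univ.image child)ᶜ,
          ((leafBox M a b x (i :: u) v.1).card : ℝ) / (M : ℝ) ^ n =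
          ((leafBox M a b x u v.1).card : ℝ) / (M : ℝ) ^ n := by
        rintro ⟨v, hv⟩ hmem
        have hne : ∀ j, v ≠ j :: u := by
          intro j hj
          simp only [Finset.mem_compl, Finset.mem_image, Finset.mem_univ, true_and, not_exists,
            child, Subtype.mk.injEq] at hmem
          exact hmem j hj.symm
        have h2 : ¬ (v ≠ [] ∧ v.tail = u) := by
          rintro ⟨h0, e⟩
          obtain ⟨j, m, rfl⟩ := List.exists_cons_of_ne_nil h0
          exact hne j (by rw [← e]; rfl)
        simp only [leafBox, if_neg (hne i), if_neg h2]
      rw [Finset.prod_congr rfl fun j _ => e1 j, Finset.prod_congr rfl fun j _ => e2 j,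
        Finset.prod_congr rfl e3, Finset.prod_const_one, one_mul, mul_comm]
    have hmid : ∀ q, IsMiddle w (square a b x q q) := fun q => isMiddle_square hlo hhi q q
    have h1 := countNe_of_isMiddle (hmid (!p)) p
    have h2 := countNe_of_isMiddle (hmid p) p
    rw [hsplit, hF, List.length_cons, pow_succ]
    exact mul_le_mul (ih hu') (h _ _ h1.1 h1.2 h2.1 h2.2) hκ
      ((pow_nonneg hκ _).trans (ih hu'))

open Classical in
/-- A square in the middle layers is in one leaf with constant probability. -/
theorem le_card_squareInLeaf (hM : 0 < M) {w : ℕ} {a b : Fin n} {x : Cube n}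
    (hlo : IsMiddle w (square a b x false false)) (hhi : IsMiddle w (square a b x true true))
    {κ : ℝ} (hκ : 0 ≤ κ)
    (h : ∀ z z' : ℕ, n ≤ 2 * z + 2 * w → 2 * z ≤ n + 2 * w → n ≤ 2 * z' + 2 * w →
      2 * z' ≤ n + 2 * w →
      κ ≤ (1 - 1 / (M : ℝ)) ^ z * (1 - (1 - 1 / (M : ℝ)) ^ z') ^ (N - 1)) :
    (N * κ) ^ L * Fintype.card (Node N L → Fin n → Fin M) ≤
      ((Finset.univ.filter fun ω : Node N L → Fin n → Fin M =>
        SquareInLeaf w L (constraint ω) a b x).card : ℝ) := by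
  have hM' : (0 : ℝ) < (M : ℝ) ^ n := by
    have : (0 : ℝ) < M := by exact_mod_cast hM
    positivity
  let E : List.Vector (Fin N) L → Finset (Node N L → Fin n → Fin M) := fun u =>
    Fintype.piFinset fun v => leafBox M a b x u.1 v.1
  have hreach : ∀ u, ∀ ω ∈ E u, ∀ α β, Reach w (constraint ω) u.1 (square a b x α β) :=
    fun u ω hω => reach_of_mem_leafBox hlo hhi u.2.le (Fintype.mem_piFinset.1 hω)
  have hE : ∀ u, κ ^ L * Fintype.card (Node N L → Fin n → Fin M) ≤ ((E u).card : ℝ) := by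
    intro u
    have h1 := card_leafBox_le (L := L) hM hlo hhi hκ h u.2.le
    rw [u.2, Finset.prod_div_distrib, Finset.prod_const, le_div_iff₀ (by positivity)] at h1
    rw [Fintype.card_piFinset, Nat.cast_prod]
    refine le_trans (le_of_eq ?_) h1
    simp
  calc (N * κ) ^ L * Fintype.card (Node N L → Fin n → Fin M)
      = ∑ _u : List.Vector (Fin N) L, κ ^ L * (Fintype.card (Node N L → Fin n → Fin M) : ℝ) := by
        rw [Finset.sum_const, Finset.card_univ, card_vector, Fintype.card_fin, nsmul_eq_mul]
        push_cast
        ring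
    _ ≤ ∑ u, ((E u).card : ℝ) := Finset.sum_le_sum fun u _ => hE u
    _ = ((Finset.univ.biUnion E).card : ℝ) := by
        -- The boxes of different leaves are disjoint, since a point reaches at most one leaf.
        rw [Finset.card_biUnion]
        · push_cast
          rfl
        · intro u _ u' _ hne
          refine Finset.disjoint_left.2 ?_
          intro ω hω hω'
          exact hne (Subtype.ext ((hreach u ω hω true true).unique (hreach u' ω hω' true true)
            (u.2.trans u'.2.symm)))
    _ ≤ _ := by
        refine Nat.cast_le.2 (Finset.card_le_card fun ω hω => ?_)
        obtain ⟨u, -, hω⟩ := Finset.mem_biUnion.1 hω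
        simp only [Finset.mem_filter, Finset.mem_univ, true_and]
        exact ⟨u.1, u.2, hreach u ω hω⟩

end MonotonicityTesting

/-! ### Number of children and size of the middle layers -/

namespace MonotonicityTesting

variable {n : ℕ}

theorem exp_neg_two_mul_le {t : ℝ} (h0 : 0 ≤ t) (h1 : t ≤ 1 / 2) : Real.exp (-(2 * t)) ≤ 1 - t := by
  rw [Real.exp_neg, inv_le_comm₀ (Real.exp_pos _) (by linarith)]
  refine le_trans ?_ (Real.add_one_le_exp (2 * t))
  rw [inv_le_iff_one_le_mul₀ (by linarith)]
  nlinarith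

theorem exp_neg_two_le_pow {M : ℕ} (hM : 2 ≤ M) : Real.exp (-2) ≤ (1 - 1 / (M : ℝ)) ^ M := by
  have hM' : (2 : ℝ) ≤ M := by exact_mod_cast hM
  have h := exp_neg_two_mul_le (t := 1 / (M : ℝ)) (by positivity)
    (one_div_le_one_div_of_le (by norm_num) hM')
  calc Real.exp (-2) = Real.exp (-(2 * (1 / (M : ℝ)))) ^ M := by
        rw [← Real.exp_nat_mul]
        congr 1
        field_simp
    _ ≤ _ := pow_le_pow_left₀ (Real.exp_pos _).le h _

theorem pow_le_exp_neg {M : ℕ} (hM : 1 ≤ M) (k : ℕ) :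
    (1 - 1 / (M : ℝ)) ^ k ≤ Real.exp (-(k / M)) := by
  have hM' : (1 : ℝ) ≤ M := by exact_mod_cast hM
  have h0 : (0 : ℝ) ≤ 1 - 1 / (M : ℝ) := by
    rw [sub_nonneg, div_le_one (by linarith)]
    exact hM'
  calc (1 - 1 / (M : ℝ)) ^ k ≤ Real.exp (-(1 / (M : ℝ))) ^ k :=
        pow_le_pow_left₀ h0 (Real.one_sub_le_exp_neg _) _
    _ = _ := by
        rw [← Real.exp_nat_mul]
        congr 1
        ring

/-- The lower bound for the probability that a point satisfies a given child of a node and none of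
its siblings, multiplied by the number of children. -/
noncomputable def levelConst : ℝ := Real.exp (-2) * Real.exp (-(4 * Real.exp 2))

theorem levelConst_pos : 0 < levelConst := mul_pos (Real.exp_pos _) (Real.exp_pos _)

theorem levelConst_le_one : levelConst ≤ 1 := by
  unfold levelConst
  rw [← Real.exp_add, Real.exp_le_one_iff]
  have := Real.exp_pos 2
  linarith

/-- Take `N` to be about the inverse of the probability that a point with `n / 2` wrong coordinates
satisfies a constraint. Since the width of the middle layers is `M`, moving within them changes this
probability by at most a constant factor, because `(1 - 1 / M) ^ M` is bounded below. -/
theorem exists_branching {M : ℕ} (hM : 2 ≤ M) (hn : 3 * M ≤ n / 2) :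
    ∃ N : ℕ, 0 < N ∧ ∀ z z' : ℕ, n ≤ 2 * z + 2 * M → 2 * z ≤ n + 2 * M → n ≤ 2 * z' + 2 * M →
      2 * z' ≤ n + 2 * M →
      levelConst / N ≤ (1 - 1 / (M : ℝ)) ^ z * (1 - (1 - 1 / (M : ℝ)) ^ z') ^ (N - 1) := by
  set h := n / 2 with hh
  have hM' : (2 : ℝ) ≤ M := by exact_mod_cast hM
  have hlow := exp_neg_two_le_pow hM
  have hhalf : ((1 : ℝ) - 1 / (M : ℝ)) ^ h ≤ Real.exp (-3) := by
    refine (pow_le_exp_neg (by omega) h).trans (Real.exp_le_exp.2 (neg_le_neg ?_))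
    rw [le_div_iff₀ (by linarith)]
    exact_mod_cast hn
  set ρ : ℝ := 1 - 1 / (M : ℝ) with hρ
  have hρ0 : 0 < ρ := by
    have : 1 / (M : ℝ) ≤ 1 / 2 := one_div_le_one_div_of_le (by norm_num) hM'
    linarith
  have hρ1 : ρ ≤ 1 := by
    have : (0 : ℝ) ≤ 1 / (M : ℝ) := by positivity
    linarith
  have hρh : 0 < ρ ^ h := pow_pos hρ0 _
  have hρh1 : ρ ^ h ≤ 1 := pow_le_one₀ hρ0.le hρ1
  set N := ⌈1 / ρ ^ h⌉₊ with hN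
  have hN1 : 1 ≤ N * ρ ^ h := by
    have := Nat.le_ceil (1 / ρ ^ h)
    rwa [div_le_iff₀ hρh] at this
  have hN2 : N * ρ ^ h ≤ 2 := by
    have h1 := (Nat.ceil_lt_add_one (one_div_pos.2 hρh).le).le
    calc N * ρ ^ h ≤ (1 / ρ ^ h + 1) * ρ ^ h := mul_le_mul_of_nonneg_right h1 hρh.le
      _ = 1 + ρ ^ h := by field_simp
      _ ≤ 2 := by linarith
  have hNpos : 0 < N := Nat.ceil_pos.2 (one_div_pos.2 hρh)
  have hNR : (0 : ℝ) < N := by exact_mod_cast hNpos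
  refine ⟨N, hNpos, fun z z' _ hz hz' _ => ?_⟩
  have e1 : Real.exp (-2) ≤ N * ρ ^ z := by
    have h1 : ρ ^ (h + M) ≤ ρ ^ z := pow_le_pow_of_le_one hρ0.le hρ1 (by omega)
    calc Real.exp (-2) ≤ 1 * ρ ^ M := by rw [one_mul]; exact hlow
      _ ≤ (N * ρ ^ h) * ρ ^ M := mul_le_mul_of_nonneg_right hN1 (pow_pos hρ0 _).le
      _ = N * ρ ^ (h + M) := by rw [pow_add]; ring
      _ ≤ N * ρ ^ z := mul_le_mul_of_nonneg_left h1 hNR.le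
  have e2 : ρ ^ z' ≤ ρ ^ h * Real.exp 2 := by
    have h1 : ρ ^ (z' + M) ≤ ρ ^ h := pow_le_pow_of_le_one hρ0.le hρ1 (by omega)
    have h2 : 1 ≤ ρ ^ M * Real.exp 2 := by
      have := mul_le_mul_of_nonneg_right hlow (Real.exp_pos 2).le
      rwa [← Real.exp_add, neg_add_cancel, Real.exp_zero] at this
    calc ρ ^ z' ≤ ρ ^ z' * (ρ ^ M * Real.exp 2) :=
          le_mul_of_one_le_right (pow_pos hρ0 _).le h2
      _ = ρ ^ (z' + M) * Real.exp 2 := by rw [pow_add]; ring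
      _ ≤ _ := mul_le_mul_of_nonneg_right h1 (Real.exp_pos 2).le
  -- Here `3 * M ≤ n / 2` is needed: the factor `exp (-3)` beats the loss `exp 2`, which brings `ρ ^
  -- z'` into the range of `exp_neg_two_mul_le`.
  have e3 : ρ ^ z' ≤ 1 / 2 := by
    refine e2.trans ((mul_le_mul_of_nonneg_right hhalf (Real.exp_pos 2).le).trans ?_)
    rw [← Real.exp_add]
    norm_num
    have := Real.exp_neg_one_lt_half
    linarith
  have e4 : N * ρ ^ z' ≤ 2 * Real.exp 2 := by
    calc N * ρ ^ z' ≤ N * (ρ ^ h * Real.exp 2) := mul_le_mul_of_nonneg_left e2 hNR.le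
      _ = (N * ρ ^ h) * Real.exp 2 := by ring
      _ ≤ _ := mul_le_mul_of_nonneg_right hN2 (Real.exp_pos 2).le
  have hz0 : 0 ≤ ρ ^ z' := (pow_pos hρ0 _).le
  have e5 : Real.exp (-(4 * Real.exp 2)) ≤ (1 - ρ ^ z') ^ (N - 1) := by
    calc Real.exp (-(4 * Real.exp 2)) ≤ Real.exp (-(2 * ρ ^ z')) ^ N := by
          rw [← Real.exp_nat_mul]
          refine Real.exp_le_exp.2 ?_
          linarith
      _ ≤ (1 - ρ ^ z') ^ N := pow_le_pow_left₀ (Real.exp_pos _).le (exp_neg_two_mul_le hz0 e3) _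
      _ ≤ (1 - ρ ^ z') ^ (N - 1) :=
          pow_le_pow_of_le_one (by linarith) (by linarith) (Nat.sub_le _ _)
  rw [div_le_iff₀ hNR, levelConst]
  calc _ ≤ (N * ρ ^ z) * (1 - ρ ^ z') ^ (N - 1) :=
        mul_le_mul e1 e5 (Real.exp_pos _).le (by positivity)
    _ = _ := by ring

theorem weight_square_le (a b : Fin n) (x : Cube n) (α β : Bool) :
    weight (square a b x α β) ≤ weight x + 2 := by
  have h : (Finset.univ.filter fun c => square a b x α β c = true) ⊆
      insert a (insert b (Finset.univ.filter fun c => x c = true)) := by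
    intro c hc
    simp only [square, Function.update_apply, Finset.mem_filter, Finset.mem_univ, true_and] at hc
    simp only [Finset.mem_insert, Finset.mem_filter, Finset.mem_univ, true_and]
    split_ifs at hc <;> simp_all
  have h1 := Finset.card_insert_le a (insert b (Finset.univ.filter fun c => x c = true))
  have h2 := Finset.card_insert_le b (Finset.univ.filter fun c => x c = true)
  have h3 := Finset.card_le_card h
  unfold weight
  omega

theorem weight_le_square (a b : Fin n) (x : Cube n) (α β : Bool) :
    weight x ≤ weight (square a b x α β) + 2 := by
  have h : (Finset.univ.filter fun c => x c = true) ⊆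
      insert a (insert b (Finset.univ.filter fun c => square a b x α β c = true)) := by
    intro c hc
    simp only [Finset.mem_filter, Finset.mem_univ, true_and] at hc
    simp only [square, Function.update_apply, Finset.mem_insert, Finset.mem_filter,
      Finset.mem_univ, true_and]
    by_cases hca : c = a <;> by_cases hcb : c = b <;> simp_all
  have h1 := Finset.card_insert_le a
    (insert b (Finset.univ.filter fun c => square a b x α β c = true))
  have h2 := Finset.card_insert_le b (Finset.univ.filter fun c => square a b x α β c = true)
  have h3 := Finset.card_le_card h
  unfold weight
  omega

theorem isMiddle_square_of_isMiddle {w : ℕ} {x : Cube n} (h : IsMiddle w x) (a b : Fin n)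
    (α β : Bool) : IsMiddle (w + 2) (square a b x α β) := by
  have := weight_square_le a b x α β
  have := weight_le_square a b x α β
  have := h.1
  have := h.2
  constructor <;> omega

/-- The sign of a bit. -/
def bitSign (p : Bool) : ℝ := if p then 1 else -1

theorem sum_sign_mul_sign {c c' : Fin n} (h : c ≠ c') :
    ∑ x : Cube n, bitSign (x c) * bitSign (x c') = 0 := by
  refine Finset.sum_involution (fun x _ => Function.update x c (!x c)) ?_ ?_ ?_ ?_
  · intro x _
    simp only [Function.update_self, Function.update_of_ne h.symm]
    cases x c <;> cases x c' <;> simp [bitSign]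
  · intro x _ _ he
    have := congrFun he c
    simp at this
  · intro x _
    exact Finset.mem_univ _
  · intro x _
    simp

theorem two_mul_weight_sub (x : Cube n) : 2 * (weight x : ℝ) - n = ∑ c, bitSign (x c) := by
  have : ∀ c, bitSign (x c) = 2 * (if x c = true then 1 else 0) - 1 := by
    intro c
    cases x c <;> norm_num [bitSign]
  simp_rw [this]
  rw [Finset.sum_sub_distrib, ← Finset.mul_sum, Finset.sum_boole]
  simp [weight]

/-- The variance of a sum of `n` pairwise uncorrelated signs. -/
theorem sum_sq_weight (n : ℕ) : ∑ x : Cube n, (2 * (weight x : ℝ) - n) ^ 2 = (n : ℝ) * 2 ^ n := by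
  have h1 : ∀ x : Cube n, (2 * (weight x : ℝ) - n) ^ 2 =
      ∑ c, ∑ c', bitSign (x c) * bitSign (x c') := by
    intro x
    rw [two_mul_weight_sub, sq, Finset.sum_mul_sum]
  simp_rw [h1]
  rw [Finset.sum_comm]
  have h2 : ∀ c : Fin n, ∑ x : Cube n, ∑ c', bitSign (x c) * bitSign (x c') = 2 ^ n := by
    intro c
    rw [Finset.sum_comm, Finset.sum_eq_single c]
    · have : ∀ x : Cube n, bitSign (x c) * bitSign (x c) = 1 := by
        intro x
        cases x c <;> simp [bitSign]
      simp [this]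
    · intro c' _ hc'
      exact sum_sign_mul_sign hc'.symm
    · simp
  simp_rw [h2]
  simp

open Classical in
/-- At least half of the points are in the middle layers. -/
theorem le_card_isMiddle {w : ℕ} (hw : n ≤ 2 * w ^ 2) :
    (2 : ℝ) ^ n / 2 ≤ ((Finset.univ.filter fun x : Cube n => IsMiddle w x).card : ℝ) := by
  have hsum := sum_sq_weight n
  have h1 : (2 : ℝ) ^ n = (Finset.univ.filter fun x : Cube n => IsMiddle w x).card +
      (Finset.univ.filter fun x : Cube n => ¬ IsMiddle w x).card := by
    have := Finset.card_filter_add_card_filter_not (s := (Finset.univ : Finset (Cube n)))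
      fun x => IsMiddle w x
    rw [Finset.card_univ, Fintype.card_fun, Fintype.card_bool, Fintype.card_fin] at this
    exact_mod_cast this.symm
  by_cases hn : n = 0
  · subst hn
    have : (Finset.univ.filter fun x : Cube 0 => ¬ IsMiddle w x) = ∅ := by
      refine Finset.filter_false_of_mem fun x _ => not_not.2 ⟨by omega, ?_⟩
      simp [weight]
    rw [this] at h1
    simp only [Finset.card_empty, Nat.cast_zero, add_zero] at h1
    rw [← h1]
    norm_num
  have hn' : (0 : ℝ) < n := by exact_mod_cast Nat.pos_of_ne_zero hn
  have hw' : (n : ℝ) ≤ 2 * (w : ℝ) ^ 2 := by exact_mod_cast hw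
  -- Chebyshev's inequality: outside the middle layers the square exceeds `4 * w ^ 2`, which is at
  -- least `2 * n`.
  have h2 : ((Finset.univ.filter fun x : Cube n => ¬ IsMiddle w x).card : ℝ) * (2 * n) ≤
      n * 2 ^ n := by
    rw [← hsum, ← nsmul_eq_mul, ← Finset.sum_const]
    refine le_trans ?_ (Finset.sum_le_sum_of_subset_of_nonneg
      (Finset.filter_subset (fun x : Cube n => ¬ IsMiddle w x) _) fun x _ _ => sq_nonneg _)
    refine Finset.sum_le_sum fun x hx => ?_
    have hx := (Finset.mem_filter.1 hx).2
    simp only [IsMiddle, not_and_or, not_le] at hx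
    have hw0 : (0 : ℝ) ≤ w := Nat.cast_nonneg _
    rcases hx with hx | hx
    · have : 2 * (weight x : ℝ) + 2 * w < n := by exact_mod_cast hx
      nlinarith
    · have : (n : ℝ) + 2 * w < 2 * weight x := by exact_mod_cast hx
      nlinarith
  have h3 : ((Finset.univ.filter fun x : Cube n => ¬ IsMiddle w x).card : ℝ) ≤ 2 ^ n / 2 := by
    have : ((Finset.univ.filter fun x : Cube n => ¬ IsMiddle w x).card : ℝ) * (2 * n) ≤
      (2 ^ n / 2) * (2 * n) := by linarith
    exact le_of_mul_le_mul_right this (by linarith)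
  linarith

end MonotonicityTesting

/-! ### Averaging over testers, constraints and pairs of coordinates -/

namespace MonotonicityTesting

variable {n N M L : ℕ}

theorem RoundAdaptiveAlgorithm.prob_eq_tsum {r : ℕ} (A : RoundAdaptiveAlgorithm n r)
    (f : Cube n → Bool) (b : Bool) :
    A.prob f b = ∑' T, A T * if T.run f = b then 1 else 0 := by
  unfold RoundAdaptiveAlgorithm.prob
  rw [PMF.map_apply]
  refine tsum_congr fun T => ?_
  by_cases h : T.run f = b
  · simp [h]
  · simp [h, Ne.symm h]

theorem RoundAdaptiveAlgorithm.prob_true_le {r : ℕ} {A : RoundAdaptiveAlgorithm n r}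
    {f : Cube n → Bool} (h : 2 / 3 ≤ A.prob f false) : A.prob f true ≤ 1 / 3 := by
  have h1 : A.prob f true + A.prob f false = 1 := by
    have := (PMF.map (fun T => T.run f) A).tsum_coe
    rw [tsum_fintype, Fintype.sum_bool] at this
    exact this
  have h2 : A.prob f true + 2 / 3 ≤ 1 / 3 + 2 / 3 := by
    have e : (1 / 3 + 2 / 3 : ENNReal) = 1 := by
      rw [ENNReal.div_add_div_same, show (1 + 2 : ENNReal) = 3 by norm_num]
      exact ENNReal.div_self (by norm_num) (by norm_num)
    rw [e, ← h1]
    exact add_le_add_right h _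
  exact (ENNReal.add_le_add_iff_right (ENNReal.div_ne_top (by norm_num) (by norm_num))).1 h2

/-- If the deterministic algorithms in the support of a tester hardly distinguish between two
families, one of monotone functions and one of functions that are far from monotone, then the
families are small. -/
theorem card_le_of_isMonotonicityTester {ι : Type*} {r : ℕ} {ε : ℝ}
    {A : RoundAdaptiveAlgorithm n r} (hA : IsMonotonicityTester ε A) (J : Finset ι)
    (F G : ι → Cube n → Bool) (hF : ∀ i ∈ J, Monotone (F i))
    (hG : ∀ i ∈ J, IsFarFromMonotone ε (G i)) (e : ℕ)
    (h : ∀ T ∈ A.support, (J.filter fun i => T.run (F i) = true).card ≤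
      (J.filter fun i => T.run (G i) = true).card + e) :
    J.card ≤ 3 * e := by
  have hsum : ∀ H : ι → Cube n → Bool, ∑ i ∈ J, A.prob (H i) true =
      ∑' T, A T * ((J.filter fun i => T.run (H i) = true).card : ENNReal) := by
    intro H
    simp_rw [RoundAdaptiveAlgorithm.prob_eq_tsum]
    rw [← Summable.tsum_finsetSum fun _ _ => ENNReal.summable]
    refine tsum_congr fun T => ?_
    rw [← Finset.mul_sum, Finset.sum_boole]
  have hcmp : ∑ i ∈ J, A.prob (F i) true ≤ ∑ i ∈ J, A.prob (G i) true + e := by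
    rw [hsum, hsum]
    calc ∑' T, A T * ((J.filter fun i => T.run (F i) = true).card : ENNReal)
        ≤ ∑' T, (A T * ((J.filter fun i => T.run (G i) = true).card : ENNReal) + A T * e) := by
          refine ENNReal.tsum_le_tsum fun T => ?_
          by_cases hT : A T = 0
          · simp [hT]
          · rw [← mul_add]
            refine mul_le_mul_right ?_ _
            exact_mod_cast h T ((PMF.mem_support_iff _ _).2 hT)
      _ = _ := by rw [ENNReal.tsum_add, ENNReal.tsum_mul_right, A.tsum_coe, one_mul]
  have hlow : (J.card : ENNReal) * (2 / 3) ≤ ∑ i ∈ J, A.prob (F i) true := by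
    rw [← nsmul_eq_mul, ← Finset.sum_const]
    exact Finset.sum_le_sum fun i hi => hA.1 _ (hF i hi)
  have hupp : ∑ i ∈ J, A.prob (G i) true ≤ (J.card : ENNReal) * (1 / 3) := by
    rw [← nsmul_eq_mul, ← Finset.sum_const]
    exact Finset.sum_le_sum fun i hi =>
      RoundAdaptiveAlgorithm.prob_true_le (hA.2 _ (hG i hi))
  have hall : (J.card : ENNReal) * (2 / 3) ≤ (J.card : ENNReal) * (1 / 3) + e :=
    hlow.trans (hcmp.trans (add_le_add_left hupp _))
  have hreal := ENNReal.toReal_mono (by finiteness) hall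
  rw [ENNReal.toReal_add (by finiteness) (by finiteness)] at hreal
  simp only [ENNReal.toReal_mul, ENNReal.toReal_div, ENNReal.toReal_natCast, ENNReal.toReal_one,
    ENNReal.toReal_ofNat] at hreal
  have : (J.card : ℝ) ≤ 3 * e := by linarith
  exact_mod_cast this

open Classical in
theorem card_pairs_le (E : Finset (Fin n)) :
    (Finset.univ.filter fun p : Fin n × Fin n => p.1 ∈ E ∨ p.2 ∈ E).card ≤ 2 * E.card * n := by
  have h : (Finset.univ.filter fun p : Fin n × Fin n => p.1 ∈ E ∨ p.2 ∈ E) ⊆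
      (E ×ˢ Finset.univ) ∪ (Finset.univ ×ˢ E) := by
    intro p hp
    simpa using hp
  refine (Finset.card_le_card h).trans ((Finset.card_union_le _ _).trans (le_of_eq ?_))
  rw [Finset.card_product, Finset.card_product, Finset.card_univ, Fintype.card_fin]
  ring

open Classical in
/-- The queries rarely explore one of two random coordinates. -/
theorem sum_card_hit_le (hM : 0 < M) (T : BatchAlgorithm n L) {w d q : ℕ}
    (hq : ∀ f, T.queries f ≤ q) (s : Node N L → Bool) :
    (∑ ω : Node N L → Fin n → Fin M, ((Finset.univ.filter fun p : Fin n × Fin n =>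
      p.1 ∈ explored w (constraint ω) (T.asked (constFun w (constraint ω) s) L) L ∨
      p.2 ∈ explored w (constraint ω) (T.asked (constFun w (constraint ω) s) L) L).card : ℝ)) ≤
    ((1 - 1 / (M : ℝ)) ^ d * (2 * L ^ 2 * q ^ 2) * n ^ 2 + 8 * (d + w) * q * n) *
      Fintype.card (Node N L → Fin n → Fin M) := by
  set E : (Node N L → Fin n → Fin M) → Finset (Fin n) := fun ω =>
    explored w (constraint ω) (T.asked (constFun w (constraint ω) s) L) L with hE
  set P : (Node N L → Fin n → Fin M) → Prop := fun ω =>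
    GapsAtMost w d L (constraint ω) (T.batchAt (treeFun w L (constraint ω) (extendLeaf s))) with hP
  have hone : ∀ ω, ((Finset.univ.filter fun p : Fin n × Fin n =>
      p.1 ∈ E ω ∨ p.2 ∈ E ω).card : ℝ) ≤
      (if ¬ P ω then (1 : ℝ) else 0) * n ^ 2 + 8 * (d + w) * q * n := by
    intro ω
    by_cases h : P ω
    · have h1 : (E ω).card ≤ 4 * (d + w) * q := by
        refine (card_explored_le h le_rfl).trans (Nat.mul_le_mul_left _ ?_)
        rw [T.sum_card_batchAt]
        exact hq _
      have h2 : (Finset.univ.filter fun p : Fin n × Fin n => p.1 ∈ E ω ∨ p.2 ∈ E ω).card ≤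
          8 * (d + w) * q * n := by
        refine (card_pairs_le (E ω)).trans ?_
        calc 2 * (E ω).card * n ≤ 2 * (4 * (d + w) * q) * n := by gcongr
          _ = 8 * (d + w) * q * n := by ring
      simp only [h, not_true_eq_false, if_false, zero_mul, zero_add]
      exact_mod_cast h2
    · have h2 : (Finset.univ.filter fun p : Fin n × Fin n => p.1 ∈ E ω ∨ p.2 ∈ E ω).card ≤
          n ^ 2 := by
        refine (Finset.card_le_univ _).trans (le_of_eq ?_)
        rw [Fintype.card_prod, Fintype.card_fin, sq]
      have h3 : ((Finset.univ.filter fun p : Fin n × Fin n => p.1 ∈ E ω ∨ p.2 ∈ E ω).card : ℝ) ≤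
          (n : ℝ) ^ 2 := by exact_mod_cast h2
      have h4 : (0 : ℝ) ≤ 8 * (d + w) * q * n := by positivity
      simp only [h, not_false_eq_true, if_true, one_mul]
      linarith
  have hbad := card_not_gapsAtMost_le (N := N) (M := M) (w := w) (g := extendLeaf s) (d := d) T hM hq
  refine (Finset.sum_le_sum fun ω _ => hone ω).trans ?_
  rw [Finset.sum_add_distrib, ← Finset.sum_mul, Finset.sum_boole, Finset.sum_const, nsmul_eq_mul,
    Finset.card_univ, add_mul]
  refine add_le_add ?_ (le_of_eq (mul_comm _ _))
  calc _ ≤ ((1 - 1 / (M : ℝ)) ^ d * (2 * L ^ 2 * q ^ 2) *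
        Fintype.card (Node N L → Fin n → Fin M)) * (n : ℝ) ^ 2 :=
        mul_le_mul_of_nonneg_right hbad (by positivity)
    _ = _ := by ring

open Classical in
/-- The outcomes for which many squares are in one leaf. -/
noncomputable def goodOutcomes (n N M L w : ℕ) (a : ℝ) :
    Finset ((Node N L → Fin n → Fin M) × Fin n × Fin n) :=
  Finset.univ.filter fun p => p.2.1 ≠ p.2.2 ∧ a * 2 ^ n ≤
    ((Finset.univ.filter fun x => SquareInLeaf w L (constraint p.1) p.2.1 p.2.2 x).card : ℝ)

open Classical in
-- A reverse Markov argument. Half of the points are in the middle and at least half of the pairs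
-- have `a ≠ b`, so the average number of squares in a leaf is at least `δ / 4 * 2 ^ n`; outcomes
-- below the threshold `δ / 8 * 2 ^ n` supply at most half of this.
theorem le_card_goodOutcomes {w : ℕ} (hn : 2 ≤ n) {δ : ℝ} (hδ : 0 ≤ δ)
    (hw : n ≤ 2 * w ^ 2)
    (h : ∀ (a b : Fin n) (x : Cube n), IsMiddle w x →
      δ * Fintype.card (Node N L → Fin n → Fin M) ≤
      ((Finset.univ.filter fun ω : Node N L → Fin n → Fin M =>
        SquareInLeaf (w + 2) L (constraint ω) a b x).card : ℝ)) :
    δ / 8 * n ^ 2 * Fintype.card (Node N L → Fin n → Fin M) ≤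
      ((goodOutcomes n N M L (w + 2) (δ / 8)).card : ℝ) := by
  set K : ℝ := ((Fintype.card (Node N L → Fin n → Fin M) : ℕ) : ℝ) with hK
  have hK0 : 0 ≤ K := Nat.cast_nonneg _
  set W : (Node N L → Fin n → Fin M) → Fin n → Fin n → ℝ := fun ω a b =>
    ((Finset.univ.filter fun x => SquareInLeaf (w + 2) L (constraint ω) a b x).card : ℝ) with hW
  have hlow : ∀ a b : Fin n, δ * K * (2 ^ n / 2) ≤ ∑ ω, W ω a b := by
    intro a b
    have e : ∑ ω, W ω a b = ∑ x : Cube n, ((Finset.univ.filter fun ω : Node N L → Fin n → Fin M =>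
        SquareInLeaf (w + 2) L (constraint ω) a b x).card : ℝ) := by
      simp_rw [hW, ← Finset.sum_boole]
      rw [Finset.sum_comm]
    rw [e]
    calc δ * K * (2 ^ n / 2)
        ≤ δ * K * ((Finset.univ.filter fun x : Cube n => IsMiddle w x).card : ℝ) :=
          mul_le_mul_of_nonneg_left (le_card_isMiddle hw) (mul_nonneg hδ hK0)
      _ = ∑ x ∈ Finset.univ.filter fun x : Cube n => IsMiddle w x, δ * K := by
          rw [Finset.sum_const, nsmul_eq_mul, mul_comm]
      _ ≤ ∑ x ∈ Finset.univ.filter fun x : Cube n => IsMiddle w x,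
            ((Finset.univ.filter fun ω : Node N L → Fin n → Fin M =>
              SquareInLeaf (w + 2) L (constraint ω) a b x).card : ℝ) :=
          Finset.sum_le_sum fun x hx => h a b x (Finset.mem_filter.1 hx).2
      _ ≤ _ := Finset.sum_le_sum_of_subset_of_nonneg (Finset.filter_subset _ _)
          fun _ _ _ => Nat.cast_nonneg _
  have hupp : ∀ (ω : Node N L → Fin n → Fin M) (a b : Fin n), (if a ≠ b then W ω a b else 0) ≤
      (if (ω, a, b) ∈ goodOutcomes n N M L (w + 2) (δ / 8) then (1 : ℝ) else 0) * 2 ^ n +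
        δ / 8 * 2 ^ n := by
    intro ω a b
    have hWle : W ω a b ≤ 2 ^ n := by
      have : (Finset.univ.filter fun x => SquareInLeaf (w + 2) L (constraint ω) a b x).card ≤
          2 ^ n := (Finset.card_le_univ _).trans (by simp)
      simp only [hW]
      exact_mod_cast this
    have hpos : 0 ≤ δ / 8 * (2 : ℝ) ^ n := by positivity
    by_cases hab : a = b
    · rw [if_neg (not_not.2 hab)]
      split_ifs <;> positivity
    · rw [if_pos hab]
      by_cases hg : δ / 8 * 2 ^ n ≤ W ω a b
      · rw [if_pos (by simpa [goodOutcomes] using ⟨hab, hg⟩)]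
        linarith
      · have h0 : (0 : ℝ) ≤ if (ω, a, b) ∈ goodOutcomes n N M L (w + 2) (δ / 8) then 1 else 0 := by
          split_ifs <;> norm_num
        have : (0 : ℝ) ≤ 2 ^ n := by positivity
        nlinarith
  have htotal : ∑ a : Fin n, ∑ b : Fin n, (if a ≠ b then δ * K * (2 ^ n / 2) else 0) ≤
      ((goodOutcomes n N M L (w + 2) (δ / 8)).card : ℝ) * 2 ^ n + K * n ^ 2 * (δ / 8 * 2 ^ n) := by
    calc _ ≤ ∑ a : Fin n, ∑ b : Fin n, ∑ ω, (if a ≠ b then W ω a b else 0) := by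
          refine Finset.sum_le_sum fun a _ => Finset.sum_le_sum fun b _ => ?_
          split_ifs
          · exact hlow a b
          · simp
      _ = ∑ p : (Node N L → Fin n → Fin M) × Fin n × Fin n,
            (if p.2.1 ≠ p.2.2 then W p.1 p.2.1 p.2.2 else 0) := by
          simp_rw [Fintype.sum_prod_type]
          exact ((Finset.sum_comm).trans (Finset.sum_congr rfl fun a _ => Finset.sum_comm)).symm
      _ ≤ ∑ p : (Node N L → Fin n → Fin M) × Fin n × Fin n,
            ((if p ∈ goodOutcomes n N M L (w + 2) (δ / 8) then (1 : ℝ) else 0) * 2 ^ n +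
              δ / 8 * 2 ^ n) := Finset.sum_le_sum fun p _ => hupp p.1 p.2.1 p.2.2
      _ = _ := by
          rw [Finset.sum_add_distrib, ← Finset.sum_mul, Finset.sum_boole, Finset.sum_const,
            nsmul_eq_mul, Finset.card_univ, Fintype.card_prod, Fintype.card_prod, Fintype.card_fin]
          push_cast
          congr 2
          · simp
          · ring
  have hpairs : ∑ a : Fin n, ∑ b : Fin n, (if a ≠ b then δ * K * (2 ^ n / 2) else 0) =
      (n * (n - 1)) * (δ * K * (2 ^ n / 2)) := by
    have : ∀ a : Fin n, ∑ b : Fin n, (if a ≠ b then δ * K * (2 ^ n / 2) else 0) =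
        (n - 1) * (δ * K * (2 ^ n / 2)) := by
      intro a
      rw [← Finset.sum_filter, Finset.sum_const, nsmul_eq_mul, Finset.filter_ne,
        Finset.card_erase_of_mem (Finset.mem_univ _), Finset.card_univ, Fintype.card_fin,
        Nat.cast_sub (by omega), Nat.cast_one]
    simp_rw [this]
    rw [Finset.sum_const, nsmul_eq_mul, Finset.card_univ, Fintype.card_fin]
    ring
  rw [hpairs] at htotal
  have hn' : (2 : ℝ) ≤ n := by exact_mod_cast hn
  have hn2 : (n : ℝ) ^ 2 / 2 ≤ n * (n - 1) := by nlinarith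
  have h1 := mul_le_mul_of_nonneg_right hn2
    (show 0 ≤ δ * K * ((2 : ℝ) ^ n / 2) by positivity)
  have h2 : (δ / 8 * n ^ 2 * K) * 2 ^ n ≤
      ((goodOutcomes n N M L (w + 2) (δ / 8)).card : ℝ) * 2 ^ n := by
    linarith
  exact le_of_mul_le_mul_right h2 (by positivity)

end MonotonicityTesting

/-! ### The lower bound for the number of queries -/

namespace MonotonicityTesting

variable {n N M L : ℕ}

/-- The probability bound for the event that the queries explore one of two random coordinates. -/
noncomputable def hitBound (n M L w d q : ℕ) : ℝ :=
  (1 - 1 / (M : ℝ)) ^ d * (2 * L ^ 2 * q ^ 2) * n ^ 2 + 8 * (d + w) * q * n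

theorem hitBound_nonneg (hM : 0 < M) (w d q : ℕ) : 0 ≤ hitBound n M L w d q := by
  have h : (0 : ℝ) ≤ 1 - 1 / (M : ℝ) := by
    rw [sub_nonneg, div_le_one (by exact_mod_cast hM)]
    exact_mod_cast hM
  unfold hitBound
  positivity

open Classical in
theorem sum_card_filter_comm {Ω P S : Type*} [Fintype Ω] [Fintype P] [Fintype S]
    (hit : Ω → P → S → Prop) :
    ∑ p : Ω × P, ((Finset.univ.filter fun s => hit p.1 p.2 s).card : ℝ) =
      ∑ s, ∑ ω, ((Finset.univ.filter fun p => hit ω p s).card : ℝ) := by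
  simp_rw [← Finset.sum_boole]
  rw [Finset.sum_comm]
  exact Finset.sum_congr rfl fun s _ => Fintype.sum_prod_type _

open Classical in
-- The queries on the constant family depend on `ω` and `s` but not on `a` and `b`. So the errors of
-- the coupling can be summed over the pair first, and extending the sum from `Γ` to all outcomes
-- costs nothing that matters.
theorem card_run_constFun_product_le (hM : 0 < M) (T : BatchAlgorithm n L) {w d q : ℕ}
    (hq : ∀ f, T.queries f ≤ q) (Γ : Finset ((Node N L → Fin n → Fin M) × Fin n × Fin n)) :
    (((Γ ×ˢ (Finset.univ : Finset (Node N L → Bool))).filter fun i =>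
      T.run (constFun w (constraint i.1.1) i.2) = true).card : ℝ) ≤
    ((Γ ×ˢ (Finset.univ : Finset (Node N L → Bool))).filter fun i =>
      T.run (parityFun w (constraint i.1.1) i.1.2.1 i.1.2.2 i.2) = true).card +
    hitBound n M L w d q * Fintype.card (Node N L → Fin n → Fin M) *
      Fintype.card (Node N L → Bool) := by
  let hit (ω : Node N L → Fin n → Fin M) (p : Fin n × Fin n) (s : Node N L → Bool) : Prop :=
    p.1 ∈ explored w (constraint ω) (T.asked (constFun w (constraint ω) s) L) L ∨
    p.2 ∈ explored w (constraint ω) (T.asked (constFun w (constraint ω) s) L) L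
  have hsplit : ∀ (P : ((Node N L → Fin n → Fin M) × Fin n × Fin n) × (Node N L → Bool) → Prop)
      [DecidablePred P], (((Γ ×ˢ (Finset.univ : Finset (Node N L → Bool))).filter P).card : ℝ) =
        ∑ p ∈ Γ, ((Finset.univ.filter fun s => P (p, s)).card : ℝ) := by
    intro P _
    simp_rw [← Finset.sum_boole]
    rw [Finset.sum_product]
  have herr : ∑ p ∈ Γ, ((Finset.univ.filter fun s => hit p.1 p.2 s).card : ℝ) ≤
      hitBound n M L w d q * Fintype.card (Node N L → Fin n → Fin M) *
        Fintype.card (Node N L → Bool) := by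
    calc ∑ p ∈ Γ, ((Finset.univ.filter fun s => hit p.1 p.2 s).card : ℝ)
        ≤ ∑ p : (Node N L → Fin n → Fin M) × Fin n × Fin n,
            ((Finset.univ.filter fun s => hit p.1 p.2 s).card : ℝ) :=
          Finset.sum_le_sum_of_subset_of_nonneg (Finset.subset_univ _)
            fun _ _ _ => Nat.cast_nonneg _
      _ = ∑ s : Node N L → Bool, ∑ ω, ((Finset.univ.filter fun p => hit ω p s).card : ℝ) :=
          by convert sum_card_filter_comm hit
      _ ≤ ∑ s : Node N L → Bool,
            hitBound n M L w d q * Fintype.card (Node N L → Fin n → Fin M) :=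
          Finset.sum_le_sum fun s _ => sum_card_hit_le hM T hq s
      _ = _ := by rw [Finset.sum_const, nsmul_eq_mul, Finset.card_univ, mul_comm]
  refine le_trans ?_ (add_le_add_right herr _)
  rw [hsplit, hsplit, ← Finset.sum_add_distrib]
  refine Finset.sum_le_sum fun p _ => ?_
  exact_mod_cast card_run_constFun_le w (constraint p.1) p.2.1 p.2.2 T

open Classical in
theorem card_goodOutcomes_le {r w q : ℕ} {ε : ℝ} {A : RoundAdaptiveAlgorithm n r}
    (hA : IsMonotonicityTester ε A) (hM : 0 < M) (d : ℕ)
    (hq : ∀ T ∈ A.support, ∀ f, T.queries f ≤ q) :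
    ((goodOutcomes n N M (r + 1) w (4 * ε)).card : ℝ) ≤
      3 * hitBound n M (r + 1) w d q * Fintype.card (Node N (r + 1) → Fin n → Fin M) := by
  set Γ := goodOutcomes n N M (r + 1) w (4 * ε) with hΓ
  set K : ℝ := ((Fintype.card (Node N (r + 1) → Fin n → Fin M) : ℕ) : ℝ) with hK
  set S : ℝ := ((Fintype.card (Node N (r + 1) → Bool) : ℕ) : ℝ) with hS
  have hS0 : 0 < S := by
    rw [hS]
    exact_mod_cast Fintype.card_pos
  have hB := hitBound_nonneg (n := n) (L := r + 1) hM w d q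
  have hbound : 0 ≤ hitBound n M (r + 1) w d q * K * S := by positivity
  have h := card_le_of_isMonotonicityTester hA
    (Γ ×ˢ (Finset.univ : Finset (Node N (r + 1) → Bool)))
    (fun i => constFun w (constraint i.1.1) i.2)
    (fun i => parityFun w (constraint i.1.1) i.1.2.1 i.1.2.2 i.2)
    (fun i _ => constFun_monotone _ _ _)
    (fun i hi g hg => by
      have hi' := (Finset.mem_filter.1 (Finset.mem_product.1 hi).1).2
      have h1 := card_squareInLeaf_le (w := w) (L := r + 1) (D := constraint i.1.1) hi'.1 i.2 hg
      have h2 : ((Finset.univ.filter fun x =>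
          SquareInLeaf w (r + 1) (constraint i.1.1) i.1.2.1 i.1.2.2 x).card : ℝ) ≤
          4 * (hammingDist (parityFun w (constraint i.1.1) i.1.2.1 i.1.2.2 i.2) g : ℝ) := by
        exact_mod_cast h1
      linarith [hi'.2.trans h2])
    -- The error in the comparison of testers is a natural number; rounding down is harmless because
    -- it is compared with a difference of cardinalities.
    ⌊hitBound n M (r + 1) w d q * K * S⌋₊
    (fun T hT => by
      have h1 := card_run_constFun_product_le (w := w) (d := d) hM T (hq T hT) Γ
      have h2 := Nat.le_floor h1
      rwa [add_comm (Nat.cast _ : ℝ), Nat.floor_add_natCast hbound,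
        add_comm _ (Finset.card _)] at h2)
  rw [Finset.card_product, Finset.card_univ] at h
  have h1 : (Γ.card : ℝ) * S ≤ 3 * ⌊hitBound n M (r + 1) w d q * K * S⌋₊ := by
    rw [hS]
    exact_mod_cast h
  have h2 := Nat.floor_le hbound
  refine le_of_mul_le_mul_right ?_ hS0
  linarith

/-- The number of queries of a tester cannot be too small. -/
theorem le_hitBound {r q : ℕ} (hn : 100 ≤ n) {A : RoundAdaptiveAlgorithm n r}
    (hA : IsMonotonicityTester (levelConst ^ (r + 1) / 32) A) (d : ℕ)
    (hq : ∀ T ∈ A.support, ∀ f, T.queries f ≤ q) :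
    levelConst ^ (r + 1) / 8 * n ^ 2 ≤
      3 * hitBound n (Nat.sqrt n + 1) (r + 1) (Nat.sqrt n + 1) d q := by
  have hs : 10 ≤ Nat.sqrt n := Nat.le_sqrt.2 (by omega)
  have hs1 := Nat.sqrt_le' n
  have hs2 := Nat.sqrt_le_add n
  obtain ⟨m, hm⟩ : ∃ m, Nat.sqrt n = m + 1 := ⟨Nat.sqrt n - 1, by omega⟩
  rw [hm] at hs hs1 hs2 ⊢
  -- With `m = √n - 1` rounded down, half of the points are within distance `m` of the middle
  -- weight, and their squares within `m + 2`, which equals `M`, as `exists_branching` requires.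
  obtain ⟨N, hN, hbr⟩ := exists_branching (n := n) (M := m + 1 + 1) (by omega)
    ((Nat.le_div_iff_mul_le (by norm_num)).2 (by nlinarith))
  have hNR : (0 : ℝ) < N := by exact_mod_cast hN
  have hκ : 0 ≤ levelConst / N := div_nonneg levelConst_pos.le hNR.le
  have hgood := le_card_goodOutcomes (n := n) (N := N) (M := m + 1 + 1) (L := r + 1) (w := m)
    (by omega) (pow_pos levelConst_pos (r + 1)).le (by nlinarith) (fun a b x hx => by
      have h := le_card_squareInLeaf (N := N) (M := m + 1 + 1) (L := r + 1) (by omega)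
        (isMiddle_square_of_isMiddle hx a b false false)
        (isMiddle_square_of_isMiddle hx a b true true) hκ hbr
      rwa [mul_div_cancel₀ _ hNR.ne'] at h)
  rw [show levelConst ^ (r + 1) / 8 = 4 * (levelConst ^ (r + 1) / 32) by ring] at hgood ⊢
  have h := hgood.trans (card_goodOutcomes_le (N := N) (M := m + 1 + 1) (w := m + 2) hA
    (by omega) d hq)
  refine le_of_mul_le_mul_right h ?_
  have : Nonempty (Node N (r + 1) → Fin n → Fin (m + 1 + 1)) := ⟨fun _ _ => 0⟩
  exact_mod_cast Fintype.card_pos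

/-- The threshold `d = ⌈2 * M * log n⌉` makes `(1 - 1 / M) ^ d` at most `n ^ (-2)`, which cancels
the `n ^ 2` of the first term and leaves it linear in `n`. In the second term `d + M` is at most `8
√n log n`, and the bound for `q` removes the logarithm. -/
theorem hitBound_le {q : ℕ} (hn : 100 ≤ n) {c : ℝ} (hc : c ≤ 1)
    (hq : (q : ℝ) ≤ c * Real.sqrt n / Real.log n) :
    hitBound n (Nat.sqrt n + 1) L (Nat.sqrt n + 1) ⌈2 * (Nat.sqrt n + 1 : ℕ) * Real.log n⌉₊ q ≤
      2 * L ^ 2 * n + 64 * c * n ^ 2 := by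
  have hnR : (100 : ℝ) ≤ n := by exact_mod_cast hn
  have hlog : 1 ≤ Real.log n := by
    rw [Real.le_log_iff_exp_le (by linarith)]
    linarith [Real.exp_one_lt_d9]
  have hsq : Real.sqrt n ^ 2 = n := Real.sq_sqrt (by linarith)
  have hsq10 : 10 ≤ Real.sqrt n := Real.le_sqrt_of_sq_le (by linarith)
  have hc0 : 0 ≤ c := by
    by_contra! h
    have : c * Real.sqrt n / Real.log n < 0 :=
      div_neg_of_neg_of_pos (mul_neg_of_neg_of_pos h (by linarith)) (by linarith)
    have : (0 : ℝ) ≤ q := Nat.cast_nonneg q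
    linarith
  set M := Nat.sqrt n + 1 with hM
  have hMR : (M : ℝ) ≤ Real.sqrt n + 1 := by
    rw [hM]
    push_cast
    linarith [Real.nat_sqrt_le_real_sqrt (a := n)]
  have hM1 : (1 : ℝ) ≤ M := by
    rw [hM]
    push_cast
    linarith [(Nat.cast_nonneg (Nat.sqrt n) : (0 : ℝ) ≤ _)]
  set d := ⌈2 * (M : ℝ) * Real.log n⌉₊ with hd
  have hd1 : 2 * (M : ℝ) * Real.log n ≤ d := Nat.le_ceil _
  have hd2 : (d : ℝ) ≤ 2 * (M : ℝ) * Real.log n + 1 := (Nat.ceil_lt_add_one (by positivity)).le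
  have hpow : (1 - 1 / (M : ℝ)) ^ d * n ^ 2 ≤ 1 := by
    have h1 : (1 - 1 / (M : ℝ)) ^ d ≤ Real.exp (-(2 * Real.log n)) := by
      refine (pow_le_exp_neg (by omega) d).trans (Real.exp_le_exp.2 (neg_le_neg ?_))
      rw [le_div_iff₀ (by linarith)]
      linarith
    have h2 : Real.exp (-(2 * Real.log n)) * (n : ℝ) ^ 2 = 1 := by
      rw [← Real.log_rpow (by linarith)]
      norm_cast
      rw [Real.exp_neg, Real.exp_log (by positivity)]
      exact inv_mul_cancel₀ (by positivity)
    calc _ ≤ Real.exp (-(2 * Real.log n)) * (n : ℝ) ^ 2 :=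
          mul_le_mul_of_nonneg_right h1 (by positivity)
      _ = 1 := h2
  have hqlog : (q : ℝ) * Real.log n ≤ c * Real.sqrt n := (le_div_iff₀ (by linarith)).1 hq
  have hq0 : (0 : ℝ) ≤ q := Nat.cast_nonneg q
  have hqn : (q : ℝ) ^ 2 ≤ n := by
    have h1 : (q : ℝ) ≤ Real.sqrt n := by nlinarith
    calc (q : ℝ) ^ 2 ≤ Real.sqrt n ^ 2 := pow_le_pow_left₀ hq0 h1 2
      _ = n := hsq
  have hdM : (d : ℝ) + M ≤ 8 * Real.sqrt n * Real.log n := by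
    have h1 : (M : ℝ) ≤ 2 * Real.sqrt n := by linarith
    nlinarith
  have hfirst : (1 - 1 / (M : ℝ)) ^ d * (2 * L ^ 2 * q ^ 2) * n ^ 2 ≤ 2 * L ^ 2 * n := by
    calc _ = ((1 - 1 / (M : ℝ)) ^ d * n ^ 2) * (2 * L ^ 2 * q ^ 2) := by ring
      _ ≤ 1 * (2 * L ^ 2 * q ^ 2) := mul_le_mul_of_nonneg_right hpow (by positivity)
      _ ≤ 2 * L ^ 2 * n := by
          rw [one_mul]
          gcongr
  have hsecond : 8 * ((d : ℝ) + M) * q * n ≤ 64 * c * n ^ 2 := by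
    calc 8 * ((d : ℝ) + M) * q * n ≤ 8 * (8 * Real.sqrt n * Real.log n) * q * n := by gcongr
      _ = 64 * Real.sqrt n * n * (q * Real.log n) := by ring
      _ ≤ 64 * Real.sqrt n * n * (c * Real.sqrt n) := by gcongr
      _ = 64 * c * n * Real.sqrt n ^ 2 := by ring
      _ = 64 * c * n ^ 2 := by rw [hsq]; ring
  exact add_le_add hfirst hsecond

end MonotonicityTesting

theorem theorem2 (r : ℕ) :
    ∃ ε : ℝ, 0 < ε ∧ ∃ c : ℝ, 0 < c ∧ ∃ k n₀ : ℕ, ∀ n : ℕ, n₀ ≤ n →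
      ∀ A : MonotonicityTesting.RoundAdaptiveAlgorithm n r,
        MonotonicityTesting.IsMonotonicityTester ε A →
          ∃ f : MonotonicityTesting.Cube n → Bool, ∃ T ∈ A.support,
            c * Real.sqrt n / Real.log n ^ k ≤ (T.queries f : ℝ) := by
  set δ : ℝ := MonotonicityTesting.levelConst ^ (r + 1) with hδ
  have hδ0 : 0 < δ := pow_pos MonotonicityTesting.levelConst_pos _
  have hδ1 : δ ≤ 1 :=
    pow_le_one₀ MonotonicityTesting.levelConst_pos.le MonotonicityTesting.levelConst_le_one
  set L : ℝ := ((r + 1 : ℕ) : ℝ) with hL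
  -- With `c = δ / 3200` the second term of the bound is `δ / 50 * n ^ 2`, and `n₀` makes the first
  -- at most `δ / 100 * n ^ 2`. Three times their sum is `9 / 100 * δ * n ^ 2`, below the required
  -- `δ / 8 * n ^ 2`.
  refine ⟨δ / 32, by positivity, δ / 3200, by positivity, 1, 100 + ⌈200 * L ^ 2 / δ⌉₊,
    fun n hn A hA => ?_⟩
  by_contra! hlow
  have hn1 : 100 ≤ n := by omega
  have hn2 : 200 * L ^ 2 ≤ δ * n := by
    have h1 : 200 * L ^ 2 / δ ≤ n := (Nat.le_ceil _).trans (by exact_mod_cast (by omega))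
    linarith [(div_le_iff₀ hδ0).1 h1]
  have hnR : (100 : ℝ) ≤ n := by exact_mod_cast hn1
  have hlogn : 0 ≤ Real.log n := Real.log_nonneg (by linarith)
  set c : ℝ := δ / 3200 with hc
  have hq := Nat.floor_le (show 0 ≤ c * Real.sqrt n / Real.log n by positivity)
  have h1 := MonotonicityTesting.le_hitBound hn1 hA
    ⌈2 * (Nat.sqrt n + 1 : ℕ) * Real.log n⌉₊ (q := ⌊c * Real.sqrt n / Real.log n⌋₊)
    fun T hT f => Nat.le_floor (by simpa using (hlow f T hT).le)
  have h2 := MonotonicityTesting.hitBound_le (L := r + 1) hn1 (by linarith) hq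
  rw [← hL] at h2
  have h3 : 2 * L ^ 2 * n ≤ δ / 100 * n ^ 2 := by nlinarith
  have h4 : 0 < δ * (n : ℝ) ^ 2 := by positivity
  have h5 : 64 * c * (n : ℝ) ^ 2 = δ / 50 * n ^ 2 := by rw [hc]; ring
  rw [← hδ] at h1
  linarith
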